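/- Let $m\ge 2$ and $n=\frac{m(m-1)}{2}$. A table $X\in[m]^n$, $X=(X_{ij})_{1\le i\le j\le m-1}$ with $X_{ij}\in[m]$, is read as a commutative multiplication table, $i*j=j*i=X_{ij}$ (products involving $m$ are undefined). Let $\langle 1\rangle$ be the smallest subset of $[m]$ that contains $1$ and contains $i*j$ whenever it contains $i,j\in[m-1]$. Define $\mathrm{GEN}_n:[m]^n\to\{0,1\}$ by $\mathrm{GEN}_n(X)=1$ if and only if $m\in\langle 1\rangle$. Encoding each entry $X_{ij}$ by the $\lceil\log_2 m\rceil$ binary digits of $X_{ij}-1$, view $\mathrm{GEN}_n$ as a Boolean function of $N=n\lceil\log_2 m\rceil$ variables; its values on bit strings that encode no table (which exist only if $m$ is not a power of $2$) may be chosen arbitrarily. A nondeterministic branching program (NBP) is a finite directed acyclic graph (parallel edges allowed) with a unique source, a unique sink and out-degree at most $2$, in which each edge either is unlabelled or is labelled by a test $x_i=0$ or $x_i=1$. It computes $f$ if, for every input $x$, $f(x)=1$ if and only if there is a source-to-sink path all of whose labels are satisfied by $x$. It is (syntactically) read-$k$ if on every source-to-sink path each variable occurs in at most $k$ labels. Its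 size is the number of labelled edges. Let $\mathrm{nBP}_k(f)$ be the minimal size of a read-$k$ NBP computing $f$. Then $$\mathrm{nBP}_k(\mathrm{GEN}_n)\ \ge\ 2^{\Omega\left(\frac{\sqrt n}{4^k k^3\sqrt{\log n}}\right)},$$ and the same bound holds with $n$ replaced by the number $N$ of Boolean variables. That is, there are an absolute constant $c>0$ and an $n_0$ such that for every $m\ge2$ with $n=\frac{m(m-1)}2\ge n_0$, every $k\ge1$, and every choice of the values of $\mathrm{GEN}_n$ on non-encodings, every read-$k$ NBP computing $\mathrm{GEN}_n$ has size at least $2^{c\sqrt n/(4^kk^3\sqrt{\log_2 n})}$ and at least $2^{c\sqrt N/(4^kk^3\sqrt{\log_2 N})}$. -/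

import Mathlib

/-- A nondeterministic branching program (NBP) over Boolean variables indexed by `ι`: a finite
directed acyclic (multi)graph with a unique source and a unique sink and out-degree at most two.
An edge is labelled by a test `x i = b` (label `some (i, b)`) or is unlabelled (label `none`). -/
structure NBP (ι : Type) where
  V : Type
  E : Type
  fintypeV : Fintype V
  fintypeE : Fintype E
  src : E → V
  tgt : E → V
  label : E → Option (ι × Bool)
  acyclic : ∀ v, ¬ Relation.TransGen (fun u w => ∃ e, src e = u ∧ tgt e = w) v v
  source : V
  sink : V
  source_iff : ∀ v, (∀ e, tgt e ≠ v) ↔ v = source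
  sink_iff : ∀ v, (∀ e, src e ≠ v) ↔ v = sink
  outdegree_le : ∀ v, {e | src e = v}.ncard ≤ 2

namespace NBP

variable {ι : Type}

/-- `B.IsPath u p v`: the list of edges `p` is a directed path of `B` from `u` to `v`. -/
def IsPath (B : NBP ι) : B.V → List B.E → B.V → Prop
  | u, [], v => u = v
  | u, e :: p, v => B.src e = u ∧ B.IsPath (B.tgt e) p v

/-- The input `x` passes every labelled edge of `p` (unlabelled edges let all inputs through). -/
def Consistent (B : NBP ι) (p : List B.E) (x : ι → Bool) : Prop :=
  ∀ e ∈ p, ∀ i b, B.label e = some (i, b) → x i = b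

/-- `B` computes `f` if the inputs with `f x = 1` are exactly those that are consistent with some
source-to-sink path. -/
def Computes (B : NBP ι) (f : (ι → Bool) → Bool) : Prop :=
  ∀ x, f x = true ↔ ∃ p, B.IsPath B.source p B.sink ∧ B.Consistent p x

/-- Syntactic read-`k`: on every source-to-sink path (consistent or not), every variable is tested
by at most `k` edges. -/
def IsReadK [DecidableEq ι] (B : NBP ι) (k : ℕ) : Prop :=
  ∀ p, B.IsPath B.source p B.sink →
    ∀ i, p.countP (fun e => decide ((B.label e).map Prod.fst = some i)) ≤ k

/-- The size of an NBP is the number of its labelled edges. -/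
noncomputable def size (B : NBP ι) : ℕ := {e | B.label e ≠ none}.ncard

end NBP

/-- The positions `(i, j)`, `i ≤ j`, of a commutative multiplication table on the first `m - 1`
elements. The elements `1, …, m` are represented by the elements `0, …, m - 1` of `Fin m`. -/
abbrev GenPair (m : ℕ) : Type := {p : Fin (m - 1) × Fin (m - 1) // p.1 ≤ p.2}

/-- The elements generated from the first element by the (partial, commutative) multiplication
`X`; products involving the last element are not defined. -/
inductive Generated {m : ℕ} (X : GenPair m → Fin m) : Fin m → Prop
  | one (a : Fin m) (ha : a.val = 0) : Generated X a
  | mul (p : GenPair m) (a b : Fin m) (hap : a.val = p.1.1.val) (hbp : b.val = p.1.2.val)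
      (ha : Generated X a) (hb : Generated X b) : Generated X (X p)

open Classical in
/-- The function GEN: does the first element generate the last one? -/
noncomputable def GEN {m : ℕ} (X : GenPair m → Fin m) : Bool :=
  decide (∃ a : Fin m, a.val + 1 = m ∧ Generated X a)

/-- The Boolean variables of GEN: each of the table entries is given by `⌈log₂ m⌉` bits. -/
abbrev GenVar (m : ℕ) : Type := GenPair m × Fin (Nat.clog 2 m)

/-- The binary encoding of a multiplication table. -/
def genEncode {m : ℕ} (X : GenPair m → Fin m) : GenVar m → Bool :=
  fun v => (X v.1).val.testBit v.2.val

/-- `f` is GEN viewed as a Boolean function: it agrees with GEN on the encodings of tables. (Bit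
strings that encode no table occur only if `m` is not a power of two; there `f` is arbitrary.) -/
def IsBooleanGEN (m : ℕ) (f : (GenVar m → Bool) → Bool) : Prop :=
  ∀ X : GenPair m → Fin m, f (genEncode X) = GEN X

/-! The bound comes from a linear code that GEN can recognize. A multiplication table can simulate a
machine that reads the bits of `x` in a fixed order, keeps one parity, and aborts when a parity
check fails (`exists_gen_embedding`). Each bit of `x` sits in a single bit of the table, so a
read-`k` program for GEN restricts to a read-`k` program for the code (`eval_iff_walkAccepts`).

Cut each accepting walk greedily into pieces, each with few variables on all walks between its ends.
Since reading is syntactically bounded, there are few pieces and every variable lies in at most `k`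
of them. For a fixed list of piece ends, a random split of the pieces leaves many variables confined
to each half (`exists_balanced_split`), so the inputs accepted along that list form a rectangle with
two large sides. Hence the accepted set is a union of at most `(size ^ 2 + 1) ^ L` rectangles
(`card_walkAccepts_le`).

A rectangle inside a code is small if any large set of parity check columns has large rank
(`IsRectangle.card_le`). A random matrix with `O(k)` ones per column has this property
(`exists_sparse_columns`), and sparsity keeps the machine short. The code has at least `2 ^ (t -
8kh)` words and a rectangle at most `2 ^ (t - 10kh)`, where `m` is of order `k ^ 2 * 2 ^ k * h` and
`L` of order `k ^ 2 * 2 ^ k`. So `log size` is at least of order `kh / L`, that is `m / (4 ^ k * k ^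
3)`. -/

/-! ### Splitting pieces at random: a second moment argument -/

open Finset in
-- A uniformly random `I` contains `s` with probability `2 ^ (-#s)`. Hence each `v` contributes
-- expectation one to `subsetWeight`.
theorem sum_powerset_indicator_subset {κ : Type*} [Fintype κ] [DecidableEq κ] (s : Finset κ) :
    ∑ I : Finset κ, (if s ⊆ I then (2 : ℝ) ^ #s else 0) = 2 ^ Fintype.card κ := by
  rw [← Finset.sum_filter, Finset.sum_const, nsmul_eq_mul]
  have h : (univ.filter fun I : Finset κ => s ⊆ I) = Finset.Icc s univ := by
    ext I; simp
  rw [h, Finset.card_Icc_finset (subset_univ s)]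
  push_cast
  rw [← pow_add, Finset.card_univ, Nat.sub_add_cancel (Finset.card_le_univ s)]

/-- The number of `v` with `N v ⊆ I`, each `v` weighted by `2 ^ #(N v)`. -/
noncomputable def subsetWeight {ι κ : Type*} [Fintype ι] [DecidableEq κ] (N : ι → Finset κ)
    (I : Finset κ) : ℝ :=
  ∑ v, if N v ⊆ I then (2 : ℝ) ^ (N v).card else 0

open Finset in
theorem sum_subsetWeight {ι κ : Type*} [Fintype ι] [Fintype κ] [DecidableEq κ]
    (N : ι → Finset κ) :
    ∑ I, subsetWeight N I = 2 ^ Fintype.card κ * Fintype.card ι := by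
  unfold subsetWeight
  rw [Finset.sum_comm]
  simp_rw [sum_powerset_indicator_subset]
  simp [mul_comm]

open Finset in
theorem sum_subsetWeight_sq {ι κ : Type*} [Fintype ι] [Fintype κ] [DecidableEq κ]
    (N : ι → Finset κ) :
    ∑ I, subsetWeight N I ^ 2 =
      2 ^ Fintype.card κ * ∑ v, ∑ u, (2 : ℝ) ^ #(N v ∩ N u) := by
  have h : ∀ I, subsetWeight N I ^ 2 = ∑ v, ∑ u, (2 : ℝ) ^ #(N v ∩ N u) *
      (if N v ∪ N u ⊆ I then (2 : ℝ) ^ #(N v ∪ N u) else 0) := by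
    intro I
    unfold subsetWeight
    rw [sq, Finset.sum_mul_sum]
    refine sum_congr rfl fun v _ => sum_congr rfl fun u _ => ?_
    simp only [union_subset_iff]
    by_cases hv : N v ⊆ I <;> by_cases hu : N u ⊆ I <;> simp [hv, hu]
    rw [← pow_add, ← pow_add, add_comm #(N v ∩ N u), card_union_add_card_inter]
  simp_rw [h]
  rw [sum_comm, mul_sum]
  refine sum_congr rfl fun v _ => ?_
  rw [sum_comm, mul_sum]
  refine sum_congr rfl fun u _ => ?_
  rw [← mul_sum, sum_powerset_indicator_subset, mul_comm]

open Finset in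
-- This is a variance bound: pairs with disjoint `N v`, `N u` are uncorrelated, every other pair
-- contributes less than `2 ^ k`, and each `v` meets at most `k * M` elements `u`.
theorem sum_subsetWeight_sub_sq_le {ι κ : Type*} [Fintype ι] [Fintype κ] [DecidableEq κ]
    (N : ι → Finset κ) (k M : ℕ) (hk : ∀ v, #(N v) ≤ k) (hM : ∀ i, #{v | i ∈ N v} ≤ M) :
    ∑ I, (subsetWeight N I - Fintype.card ι) ^ 2 ≤
      2 ^ Fintype.card κ * (Fintype.card ι * (2 ^ k * (k * M))) := by
  set t : ℝ := ((Fintype.card ι : ℕ) : ℝ) with ht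
  have h1 : ∑ I, (subsetWeight N I - t) ^ 2 =
      2 ^ Fintype.card κ * ∑ v, ∑ u, ((2 : ℝ) ^ #(N v ∩ N u) - 1) := by
    simp_rw [sub_sq, sum_add_distrib, sum_sub_distrib, ← sum_mul, ← mul_sum]
    rw [sum_subsetWeight_sq, sum_subsetWeight]
    simp [← ht]
    ring
  rw [h1]
  have h2 : ∀ v, ∑ u, ((2 : ℝ) ^ #(N v ∩ N u) - 1) ≤ 2 ^ k * (k * M) := by
    intro v
    have h3 : ∀ u, ((2 : ℝ) ^ #(N v ∩ N u) - 1) ≤ 2 ^ k * #(N v ∩ N u) := by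
      intro u
      rcases Nat.eq_zero_or_pos #(N v ∩ N u) with h0 | h0
      · simp [h0]
      · have h4 : (2 : ℝ) ^ #(N v ∩ N u) ≤ 2 ^ k :=
          pow_le_pow_right₀ (by norm_num) ((card_le_card inter_subset_left).trans (hk v))
        have h5 : (1 : ℝ) ≤ #(N v ∩ N u) := by exact_mod_cast h0
        nlinarith [pow_pos (two_pos : (0 : ℝ) < 2) k]
    refine (sum_le_sum fun u _ => h3 u).trans ?_
    rw [← mul_sum]
    gcongr
    have h6 : ∑ u, #(N v ∩ N u) ≤ k * M := by
      have h7 : ∀ u, #(N v ∩ N u) = ∑ i ∈ N v, if i ∈ N u then 1 else 0 := by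
        intro u
        rw [← card_filter, filter_mem_eq_inter]
      simp_rw [h7]
      rw [sum_comm]
      calc _ ≤ ∑ i ∈ N v, M := by
            refine sum_le_sum fun i _ => ?_
            rw [← card_filter]
            exact hM i
        _ ≤ k * M := by
            rw [sum_const, smul_eq_mul]
            exact Nat.mul_le_mul_right _ (hk v)
    exact_mod_cast h6
  gcongr
  calc _ ≤ ∑ v : ι, (2 : ℝ) ^ k * (k * M) := sum_le_sum fun v _ => h2 v
    _ = _ := by simp [ht]

open Finset in
/-- If every `v` lies in at most `k` of the pieces and the pieces are small, then the pieces can be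
split into two parts such that many `v` lie only in pieces of the first part, and many only in
pieces of the second part. -/
theorem exists_balanced_split {ι κ : Type*} [Fintype ι] [Fintype κ] [DecidableEq κ]
    (N : ι → Finset κ) (k M : ℕ) (hk : ∀ v, #(N v) ≤ k) (hM : ∀ i, #{v | i ∈ N v} ≤ M)
    (h : 8 * (2 ^ k * (k * M)) ≤ Fintype.card ι) :
    ∃ I : Finset κ, Fintype.card ι ≤ 2 ^ (k + 1) * #{v | N v ⊆ I} ∧
      Fintype.card ι ≤ 2 ^ (k + 1) * #{v | Disjoint (N v) I} := by
  have key := sum_subsetWeight_sub_sq_le N k M hk hM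
  set t : ℝ := ((Fintype.card ι : ℕ) : ℝ) with ht
  have hcompl : ∑ I : Finset κ, (subsetWeight N Iᶜ - t) ^ 2 = ∑ I, (subsetWeight N I - t) ^ 2 :=
    Fintype.sum_equiv (Equiv.ofBijective _ compl_bijective) _ _ fun I => rfl
  have h' : 8 * (2 ^ k * (k * M) : ℝ) ≤ t := by rw [ht]; exact_mod_cast h
  have ht0 : 0 ≤ t := by positivity
  -- `I` and its complement have the same distribution, so averaging the sum of both squared
  -- deviations yields one `I` that serves both sides.
  obtain ⟨I, -, hI⟩ : ∃ I ∈ (univ : Finset (Finset κ)),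
      (subsetWeight N I - t) ^ 2 + (subsetWeight N Iᶜ - t) ^ 2 ≤ t ^ 2 / 4 := by
    refine exists_le_of_sum_le ⟨∅, mem_univ _⟩ ?_
    rw [sum_add_distrib, hcompl, sum_const, nsmul_eq_mul, card_univ, Fintype.card_finset]
    push_cast
    have : (2 : ℝ) ^ Fintype.card κ * (t * (2 ^ k * (k * M))) ≤
        2 ^ Fintype.card κ * (t ^ 2 / 8) := by
      gcongr
      nlinarith
    linarith
  have hW : ∀ J : Finset κ, (subsetWeight N J - t) ^ 2 ≤ t ^ 2 / 4 →
      t ≤ 2 ^ (k + 1) * #{v | N v ⊆ J} := by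
    intro J hJ
    have h1 : t / 2 ≤ subsetWeight N J := by
      have := abs_le_of_sq_le_sq (b := t / 2) (hJ.trans_eq (by ring)) (by linarith)
      linarith [(abs_le.1 this).1]
    have h2 : subsetWeight N J ≤ 2 ^ k * #{v | N v ⊆ J} := by
      unfold subsetWeight
      rw [← sum_filter, mul_comm, ← nsmul_eq_mul, ← sum_const]
      exact sum_le_sum fun v _ => pow_le_pow_right₀ (by norm_num) (hk v)
    rw [pow_succ]
    linarith
  refine ⟨I, ?_, ?_⟩
  · have := hW I (by nlinarith [sq_nonneg (subsetWeight N Iᶜ - t)])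
    rw [ht] at this
    exact_mod_cast this
  · have := hW Iᶜ (by nlinarith [sq_nonneg (subsetWeight N I - t)])
    simp_rw [subset_compl_iff_disjoint_right] at this
    rw [ht] at this
    exact_mod_cast this

/-! ### Walks and their traces -/

/-- The list `p` is a walk along the relation `R` from `a` to `b`, both included. -/
def IsWalk {Λ : Type*} (R : Λ → Λ → Prop) (a : Λ) (p : List Λ) (b : Λ) : Prop :=
  p.IsChain R ∧ p.head? = some a ∧ p.getLast? = some b

namespace IsWalk

variable {Λ : Type*} {R : Λ → Λ → Prop} {a b c d : Λ} {p q : List Λ}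

theorem singleton (a : Λ) : IsWalk R a [a] a := ⟨List.isChain_singleton a, rfl, rfl⟩

theorem append (hp : IsWalk R a p b) (h : R b c) (hq : IsWalk R c q d) :
    IsWalk R a (p ++ q) d := by
  obtain ⟨hp1, hp2, hp3⟩ := hp
  obtain ⟨hq1, hq2, hq3⟩ := hq
  refine ⟨List.isChain_append.2 ⟨hp1, hq1, ?_⟩, ?_, ?_⟩
  · intro x hx y hy
    rw [hp3] at hx
    rw [hq2] at hy
    cases hx
    cases hy
    exact h
  · simp [List.head?_append, hp2]
  · simp [List.getLast?_append, hq3]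

theorem snoc (hp : IsWalk R a p b) (h : R b c) : IsWalk R a (p ++ [c]) c :=
  hp.append h (singleton c)

/-- The shared node `b` is kept only once; this fits `halfVars`, which omits the end point. -/
theorem append_overlap (hp : IsWalk R a (p ++ [b]) b) (hq : IsWalk R b q c) :
    IsWalk R a (p ++ q) c := by
  obtain ⟨hq1, hq2, hq3⟩ := hq
  cases q with
  | nil => simp at hq2
  | cons e q =>
    simp only [List.head?_cons, Option.some.injEq] at hq2
    subst hq2
    obtain ⟨hp1, hp2, hp3⟩ := hp
    refine ⟨?_, ?_, ?_⟩
    · have h := List.isChain_append.1 hp1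
      refine List.isChain_append.2 ⟨h.1, hq1, ?_⟩
      simpa using h.2.2
    · cases p <;> simpa using hp2
    · simp [List.getLast?_append, hq3]

theorem exists_eq_snoc (hp : IsWalk R a p b) : ∃ q, p = q ++ [b] := by
  obtain ⟨h1, h2, h3⟩ := hp
  exact List.getLast?_eq_some_iff.1 h3

theorem transGen (hp : IsWalk R a (p ++ [b]) b) (h : p ≠ []) : Relation.TransGen R a b := by
  obtain ⟨h1, h2, h3⟩ := hp
  induction p generalizing a with
  | nil => exact absurd rfl h
  | cons e p ih =>
    simp only [List.cons_append, List.head?_cons, Option.some.injEq] at h2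
    subst h2
    cases p with
    | nil =>
      simp at h1
      exact Relation.TransGen.single h1
    | cons f p =>
      simp only [List.cons_append, List.isChain_cons_cons] at h1
      exact Relation.TransGen.head h1.1 (ih (by simp) (by simpa using h1.2) (by simp)
        List.getLast?_concat)

end IsWalk

section Traces

variable {ι Λ : Type*} [Fintype ι] (R : Λ → Λ → Prop) (var : Λ → ι)

open Classical in
/-- The variables on the walks from `a` to `b`, the end point `b` excluded. -/
noncomputable def halfVars (a b : Λ) : Finset ι :=
  {v | ∃ p, IsWalk R a (p ++ [b]) b ∧ v ∈ p.map var}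

open Classical in
/-- The variables on the walks from `a` to `b`, both end points included. -/
noncomputable def closedVars (a b : Λ) : Finset ι :=
  {v | ∃ p, IsWalk R a p b ∧ v ∈ p.map var}

/-- `IsTrace R var M a τ z`: the list of pairs `τ` cuts the walks of some type from `a` to `z` into
pieces, each of which is maximal with at most `M` variables on the walks between its ends. -/
inductive IsTrace (M : ℕ) : Λ → List (Λ × Λ) → Λ → Prop
  | single (a b : Λ) (h : ∃ p, IsWalk R a p b) (hM : (halfVars R var a b).card ≤ M) :
      IsTrace M a [(a, b)] b
  | cons (a b c : Λ) (τ : List (Λ × Λ)) (z : Λ) (h : ∃ p, IsWalk R a p b)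
      (hM : (halfVars R var a b).card ≤ M) (hbc : R b c) (hM' : M < (halfVars R var a c).card)
      (hτ : IsTrace M c τ z) : IsTrace M a ((a, b) :: τ) z

variable {R var}

theorem closedVars_subset [DecidableEq ι] (a b : Λ) :
    closedVars R var a b ⊆ insert (var b) (halfVars R var a b) := by
  intro v hv
  simp only [closedVars, Finset.mem_filter, Finset.mem_univ, true_and] at hv
  obtain ⟨p, hp, hv⟩ := hv
  obtain ⟨q, rfl⟩ := hp.exists_eq_snoc
  simp only [List.map_append, List.map_cons, List.map_nil, List.mem_append,
    List.mem_singleton] at hv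
  rw [Finset.mem_insert]
  rcases hv with hv | hv
  · right
    simp only [halfVars, Finset.mem_filter, Finset.mem_univ, true_and]
    exact ⟨q, hp, hv⟩
  · exact Or.inl hv

theorem card_closedVars_le (a b : Λ) :
    (closedVars R var a b).card ≤ (halfVars R var a b).card + 1 := by
  classical
  exact (Finset.card_le_card (closedVars_subset a b)).trans (Finset.card_insert_le _ _)

theorem halfVars_self (hR : ∀ a, ¬ Relation.TransGen R a a) (a : Λ) : halfVars R var a a = ∅ := by
  ext v
  simp only [halfVars, Finset.mem_filter, Finset.mem_univ, true_and, Finset.notMem_empty,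
    iff_false, not_exists, not_and]
  intro p hp hv
  rcases eq_or_ne p [] with rfl | h
  · simp at hv
  · exact hR a (hp.transGen h)

theorem IsTrace.card_closedVars_le {M : ℕ} {a z : Λ} {τ : List (Λ × Λ)}
    (h : IsTrace R var M a τ z) : ∀ e ∈ τ, (closedVars R var e.1 e.2).card ≤ M + 1 := by
  induction h with
  | single a b h hM =>
    intro e he
    rw [List.mem_singleton] at he
    subst he
    exact (_root_.card_closedVars_le a b).trans (by lia)
  | cons a b c τ z h hM hbc hM' hτ ih =>
    intro e he
    rcases List.mem_cons.1 he with rfl | he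
    · exact (_root_.card_closedVars_le a b).trans (by lia)
    · exact ih e he

/-- The walks of different pieces can be chosen independently; this is the source of the rectangle
structure. -/
theorem IsTrace.exists_walk {M : ℕ} {a z : Λ} {τ : List (Λ × Λ)}
    (h : IsTrace R var M a τ z) {P : Λ → Prop}
    (hP : ∀ e ∈ τ, ∃ p, IsWalk R e.1 p e.2 ∧ ∀ c ∈ p, P c) :
    ∃ p, IsWalk R a p z ∧ ∀ c ∈ p, P c := by
  induction h with
  | single a b h hM => exact hP (a, b) (by simp)
  | cons a b c τ z h hM hbc hM' hτ ih =>
    obtain ⟨p, hp, hp'⟩ := hP (a, b) (by simp)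
    obtain ⟨q, hq, hq'⟩ := ih fun e he => hP e (List.mem_cons_of_mem _ he)
    refine ⟨p ++ q, hp.append hbc hq, fun d hd => ?_⟩
    rcases List.mem_append.1 hd with hd | hd
    · exact hp' d hd
    · exact hq' d hd

/-- In every piece that can meet `v`, choose a walk through `v`. The concatenation need not be
consistent with any input, so it is the syntactic read bound that limits the number of pieces
containing `v`. -/
theorem IsTrace.exists_walk_count_closedVars [DecidableEq ι] {M : ℕ} {a z : Λ}
    {τ : List (Λ × Λ)} (h : IsTrace R var M a τ z) (v : ι) :
    ∃ p, IsWalk R a p z ∧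
      τ.countP (fun e => decide (v ∈ closedVars R var e.1 e.2)) ≤ (p.map var).count v := by
  have key : ∀ a b : Λ, (∃ p, IsWalk R a p b) → ∃ p, IsWalk R a p b ∧
      (if v ∈ closedVars R var a b then 1 else 0) ≤ (p.map var).count v := by
    intro a b hab
    by_cases hv : v ∈ closedVars R var a b
    · have hv' := hv
      simp only [closedVars, Finset.mem_filter, Finset.mem_univ, true_and] at hv
      obtain ⟨p, hp, hvp⟩ := hv
      exact ⟨p, hp, by simpa [hv'] using hvp⟩
    · obtain ⟨p, hp⟩ := hab
      exact ⟨p, hp, by simp [hv]⟩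
  induction h with
  | single a b h hM =>
    obtain ⟨p, hp, hv⟩ := key a b h
    refine ⟨p, hp, ?_⟩
    simpa [List.countP_cons] using hv
  | cons a b c τ z h hM hbc hM' hτ ih =>
    obtain ⟨p, hp, hv⟩ := key a b h
    obtain ⟨q, hq, hv'⟩ := ih
    refine ⟨p ++ q, hp.append hbc hq, ?_⟩
    simp only [List.countP_cons, decide_eq_true_eq, List.map_append, List.count_append]
    lia

/-- This bounds the number of pieces. By maximality, every piece but the last, prolonged to the
start `c` of the next one, has more than `M` variables. `n v` counts the prolonged pieces meeting
`v`, and since prolonged pieces overlap only in excluded end points, a single walk reads `v` that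
often. -/
theorem IsTrace.exists_count_halfVars [DecidableEq ι] {M : ℕ} {a z : Λ} {τ : List (Λ × Λ)}
    (h : IsTrace R var M a τ z) :
    ∃ n : ι → ℕ, (∀ v, ∃ p, IsWalk R a p z ∧ n v ≤ (p.map var).count v) ∧
      (τ.length - 1) * (M + 1) ≤ ∑ v, n v := by
  induction h with
  | single a b h hM => exact ⟨fun _ => 0, fun v => h.imp fun p hp => ⟨hp, by simp⟩, by simp⟩
  | cons a b c τ z h hM hbc hM' hτ ih =>
    obtain ⟨n, hn, hsum⟩ := ih
    refine ⟨fun v => (if v ∈ halfVars R var a c then 1 else 0) + n v, fun v => ?_, ?_⟩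
    · obtain ⟨q, hq, hnq⟩ := hn v
      by_cases hv : v ∈ halfVars R var a c
      · have hv' := hv
        simp only [halfVars, Finset.mem_filter, Finset.mem_univ, true_and] at hv
        obtain ⟨p, hp, hvp⟩ := hv
        refine ⟨p ++ q, hp.append_overlap hq, ?_⟩
        have := List.count_pos_iff.2 hvp
        simp only [hv', if_true, List.map_append, List.count_append]
        lia
      · obtain ⟨p, hp⟩ := h
        refine ⟨p ++ q, hp.append hbc hq, ?_⟩
        simp only [hv, if_false, List.map_append, List.count_append]
        lia
    · rw [Finset.sum_add_distrib, ← Finset.card_filter, Finset.filter_univ_mem,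
        List.length_cons, Nat.add_sub_cancel]
      have h1 : τ.length ≤ (τ.length - 1) + 1 := by lia
      calc τ.length * (M + 1) ≤ ((τ.length - 1) + 1) * (M + 1) := Nat.mul_le_mul_right _ h1
        _ = (M + 1) + (τ.length - 1) * (M + 1) := by ring
        _ ≤ _ := Nat.add_le_add hM' hsum

/-- Every walk is cut into a trace. -/
theorem exists_isTrace_of_isWalk (hR : ∀ a, ¬ Relation.TransGen R a a) (M : ℕ) {a z : Λ}
    {p : List Λ} (hp : IsWalk R a p z) :
    ∃ τ, IsTrace R var M a τ z ∧
      ∀ e ∈ τ, ∃ q, IsWalk R e.1 q e.2 ∧ ∀ c ∈ q, c ∈ p := by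
  -- Greedy cutting: `q` is the part of the current piece walked so far and `r` the rest of the
  -- walk. A new piece starts at the next node exactly when adding it would exceed `M` variables.
  suffices H : ∀ (r : List Λ) (a b : Λ) (q : List Λ), IsWalk R a q b →
      (halfVars R var a b).card ≤ M → (b :: r).IsChain R → (b :: r).getLast? = some z →
      ∃ τ, IsTrace R var M a τ z ∧
        ∀ e ∈ τ, ∃ s, IsWalk R e.1 s e.2 ∧ ∀ c ∈ s, c ∈ q ++ r by
    obtain ⟨h1, h2, h3⟩ := hp
    cases p with
    | nil => simp at h2
    | cons b r =>
      simp only [List.head?_cons, Option.some.injEq] at h2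
      subst h2
      have := H r b b [b] (IsWalk.singleton b) (by simp [halfVars_self hR]) h1 h3
      simpa using this
  intro r
  induction r with
  | nil =>
    intro a b q hq hM _ hz
    simp only [List.getLast?_singleton, Option.some.injEq] at hz
    subst hz
    refine ⟨[(a, b)], .single a b ⟨q, hq⟩ hM, fun e he => ?_⟩
    rw [List.mem_singleton] at he
    subst he
    exact ⟨q, hq, by simp⟩
  | cons c r ih =>
    intro a b q hq hM hchain hz
    rw [List.isChain_cons_cons] at hchain
    rw [List.getLast?_cons_cons] at hz
    by_cases hc : (halfVars R var a c).card ≤ M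
    · obtain ⟨τ, hτ, hτ'⟩ := ih a c (q ++ [c]) (hq.snoc hchain.1) hc hchain.2 hz
      exact ⟨τ, hτ, by simpa using hτ'⟩
    · obtain ⟨τ, hτ, hτ'⟩ := ih c c [c] (IsWalk.singleton c) (by simp [halfVars_self hR])
        hchain.2 hz
      refine ⟨(a, b) :: τ, .cons a b c τ z ⟨q, hq⟩ hM hchain.1 (not_le.1 hc) hτ, fun e he => ?_⟩
      rcases List.mem_cons.1 he with rfl | he
      · exact ⟨q, hq, fun d hd => List.mem_append_left _ hd⟩
      · obtain ⟨s, hs, hs'⟩ := hτ' e he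
        refine ⟨s, hs, fun d hd => List.mem_append_right _ ?_⟩
        simpa using hs' d hd

end Traces

/-! ### Covering the accepted inputs by rectangles -/

theorem card_filter_getElem_eq_countP {α : Type*} (l : List α) (P : α → Prop) [DecidablePred P] :
    (Finset.univ.filter fun i : Fin l.length => P l[i]).card =
      l.countP (fun a => decide (P a)) := by
  simp only [Fin.getElem_fin]
  rw [Finset.card_filter, Fin.sum_univ_fun_getElem l (fun a => if P a then 1 else 0)]
  induction l with
  | nil => rfl
  | cons a l ih => simp [List.countP_cons, ih, add_comm]

section Cover

variable {ι β Λ : Type*} [Fintype ι] [DecidableEq ι] [Fintype β]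

/-- `x` is accepted if it satisfies all literals on some walk from a start to an end node. -/
def WalkAccepts (R : Λ → Λ → Prop) (lit : Λ → ι × β) (S T : Λ → Prop) (x : ι → β) : Prop :=
  ∃ a z p, S a ∧ T z ∧ IsWalk R a p z ∧ ∀ c ∈ p, x (lit c).1 = (lit c).2

/-- The set of inputs `Q` is closed under exchanging the values on `A` between members that agree
outside of `A ∪ B`. -/
def IsRectangle (Q : Finset (ι → β)) (A B : Finset ι) : Prop :=
  ∀ x ∈ Q, ∀ y ∈ Q, (∀ v, v ∉ A → v ∉ B → x v = y v) → A.piecewise x y ∈ Q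

open Classical in
/-- A list of pairs of nodes, padded to a function on `Fin L`, accepts `x` if it is a trace from a
start to an end node such that `x` satisfies a walk between the ends of each of its pieces. -/
noncomputable def traceInputs (R : Λ → Λ → Prop) (lit : Λ → ι × β) (S T : Λ → Prop) (M L : ℕ)
    (f : Fin L → Option (Λ × Λ)) : Finset (ι → β) :=
  {x | ∃ a z τ, S a ∧ T z ∧ IsTrace R (fun c => (lit c).1) M a τ z ∧ τ.length ≤ L ∧
    (∀ i : Fin L, f i = τ[i.1]?) ∧
    ∀ e ∈ τ, ∃ q, IsWalk R e.1 q e.2 ∧ ∀ c ∈ q, x (lit c).1 = (lit c).2}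

variable {R : Λ → Λ → Prop} {lit : Λ → ι × β} {S T : Λ → Prop} {k M L : ℕ}

theorem walkAccepts_of_mem_traceInputs {f : Fin L → Option (Λ × Λ)} {x : ι → β}
    (hx : x ∈ traceInputs R lit S T M L f) : WalkAccepts R lit S T x := by
  simp only [traceInputs, Finset.mem_filter, Finset.mem_univ, true_and] at hx
  obtain ⟨a, z, τ, ha, hz, hτ, -, -, h⟩ := hx
  obtain ⟨p, hp, hp'⟩ := hτ.exists_walk h
  exact ⟨a, z, p, ha, hz, hp, hp'⟩

/-- The greedy trace of an accepting walk has length at most `L`, because `(length - 1) * (M + 1)`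
is at most the total number of reads `k * Fintype.card ι`. -/
theorem exists_mem_traceInputs (hR : ∀ a, ¬ Relation.TransGen R a a)
    (hk : ∀ a z p, S a → T z → IsWalk R a p z →
      ∀ v, (p.map fun c => (lit c).1).count v ≤ k)
    (hL : k * Fintype.card ι < L * (M + 1)) {x : ι → β} (hx : WalkAccepts R lit S T x) :
    ∃ f, x ∈ traceInputs R lit S T M L f := by
  obtain ⟨a, z, p, ha, hz, hp, hx⟩ := hx
  obtain ⟨τ, hτ, hτ'⟩ := exists_isTrace_of_isWalk (var := fun c => (lit c).1) hR M hp
  refine ⟨fun i => τ[i.1]?, ?_⟩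
  simp only [traceInputs, Finset.mem_filter, Finset.mem_univ, true_and]
  refine ⟨a, z, τ, ha, hz, hτ, ?_, fun _ => rfl, fun e he => ?_⟩
  · obtain ⟨n, hn, hsum⟩ := hτ.exists_count_halfVars
    have h1 : ∑ v, n v ≤ k * Fintype.card ι := by
      calc _ ≤ ∑ _v : ι, k := Finset.sum_le_sum fun v _ => by
            obtain ⟨q, hq, hnq⟩ := hn v
            exact hnq.trans (hk a z q ha hz hq v)
        _ = _ := by simp [mul_comm]
    have h2 : τ.length - 1 < L :=
      lt_of_mul_lt_mul_right ((hsum.trans h1).trans_lt hL) (Nat.zero_le _)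
    lia
  · obtain ⟨q, hq, hqp⟩ := hτ' e he
    exact ⟨q, hq, fun c hc => hx c (hqp c hc)⟩

/-- All members share one trace. Split its pieces into `I` and the rest, with `A` meeting only
pieces in `I` and `B` only pieces outside. After an exchange on `A`, the pieces in `I` see `x` and
the others see `y`. -/
theorem exists_isRectangle_traceInputs
    (hk : ∀ a z p, S a → T z → IsWalk R a p z →
      ∀ v, (p.map fun c => (lit c).1).count v ≤ k)
    (hM : 8 * (2 ^ k * (k * (M + 1))) ≤ Fintype.card ι) {s : ℕ}
    (hs : 2 ^ (k + 2) * s ≤ Fintype.card ι) (f : Fin L → Option (Λ × Λ))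
    (hne : (traceInputs R lit S T M L f).Nonempty) :
    ∃ A B : Finset ι, Disjoint A B ∧ s ≤ A.card ∧ s ≤ B.card ∧
      IsRectangle (traceInputs R lit S T M L f) A B := by
  obtain ⟨x₀, hx₀⟩ := hne
  simp only [traceInputs, Finset.mem_filter, Finset.mem_univ, true_and] at hx₀
  obtain ⟨a, z, τ, ha, hz, hτ, hlen, hf, -⟩ := hx₀
  have hmem : ∀ x, x ∈ traceInputs R lit S T M L f ↔
      ∀ e ∈ τ, ∃ q, IsWalk R e.1 q e.2 ∧ ∀ c ∈ q, x (lit c).1 = (lit c).2 := by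
    intro x
    simp only [traceInputs, Finset.mem_filter, Finset.mem_univ, true_and]
    constructor
    · rintro ⟨a', z', τ', -, -, -, hlen', hf', h⟩
      have : τ' = τ := by
        refine List.ext_getElem? fun i => ?_
        rcases lt_or_ge i L with hi | hi
        · rw [← hf ⟨i, hi⟩, ← hf' ⟨i, hi⟩]
        · rw [List.getElem?_eq_none (by lia), List.getElem?_eq_none (by lia)]
      rwa [this] at h
    · exact fun h => ⟨a, z, τ, ha, hz, hτ, hlen, hf, h⟩
  let C : Fin τ.length → Finset ι := fun i =>
    closedVars R (fun c => (lit c).1) (τ[i]).1 (τ[i]).2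
  let N : ι → Finset (Fin τ.length) := fun v => {i | v ∈ C i}
  obtain ⟨I, hI, hI'⟩ := exists_balanced_split N k (M + 1) (fun v => by
      obtain ⟨p, hp, hv⟩ := hτ.exists_walk_count_closedVars v
      have h1 := card_filter_getElem_eq_countP τ
        (fun e => v ∈ closedVars R (fun c => (lit c).1) e.1 e.2)
      exact (h1.trans_le hv).trans (hk a z p ha hz hp v))
    (fun i => by
      have : (Finset.univ.filter fun v => i ∈ N v) = C i := by
        ext v
        simp [N]
      rw [this]
      exact hτ.card_closedVars_le _ (List.getElem_mem _)) hM
  set A₀ : Finset ι := {v | N v ⊆ I}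
  set B₀ : Finset ι := {v | Disjoint (N v) I}
  have hbig : ∀ n, Fintype.card ι ≤ 2 ^ (k + 1) * n → 2 * s ≤ n := by
    intro n hn
    have h1 : 2 ^ (k + 1) * (2 * s) ≤ 2 ^ (k + 1) * n := by
      calc _ = 2 ^ (k + 2) * s := by ring
        _ ≤ _ := hs.trans hn
    exact Nat.le_of_mul_le_mul_left h1 (by positivity)
  obtain ⟨A, hA, hAs⟩ := Finset.exists_subset_card_eq
    (show s ≤ A₀.card by have := hbig _ hI; lia)
  -- `A₀` and `B₀` share the variables that lie in no piece. Both have at least `2 * s` elements, so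
  -- `s` of them remain in `B₀` after removing `A`.
  refine ⟨A, B₀ \ A, Finset.disjoint_sdiff, hAs.ge, ?_, ?_⟩
  · have h1 := Finset.le_card_sdiff A B₀
    have := hbig _ hI'
    lia
  · intro x hx y hy hxy
    rw [hmem] at hx hy ⊢
    intro e he
    obtain ⟨i, hi, rfl⟩ := List.getElem_of_mem he
    have hC : ∀ q, IsWalk R (τ[i]).1 q (τ[i]).2 → ∀ c ∈ q, (⟨i, hi⟩ : Fin τ.length) ∈ N (lit c).1 := by
      intro q hq c hc
      refine Finset.mem_filter.2 ⟨Finset.mem_univ _, ?_⟩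
      simp only [C, closedVars, Finset.mem_filter, Finset.mem_univ, true_and]
      exact ⟨q, hq, List.mem_map_of_mem (f := fun c => (lit c).1) hc⟩
    by_cases hiI : (⟨i, hi⟩ : Fin τ.length) ∈ I
    · obtain ⟨q, hq, hq'⟩ := hx _ he
      refine ⟨q, hq, fun c hc => ?_⟩
      rw [← hq' c hc]
      by_cases hcA : (lit c).1 ∈ A
      · rw [Finset.piecewise_eq_of_mem _ _ _ hcA]
      · rw [Finset.piecewise_eq_of_notMem _ _ _ hcA]
        refine (hxy _ hcA fun hcB => ?_).symm
        have h1 := (Finset.mem_filter.1 (Finset.mem_sdiff.1 hcB).1).2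
        exact Finset.disjoint_left.1 h1 (hC q hq c hc) hiI
    · obtain ⟨q, hq, hq'⟩ := hy _ he
      refine ⟨q, hq, fun c hc => ?_⟩
      rw [← hq' c hc, Finset.piecewise_eq_of_notMem]
      intro hcA
      exact hiI ((Finset.mem_filter.1 (hA hcA)).2 (hC q hq c hc))

open Classical in
/-- If all rectangles inside the accepted set of a read-`k` program are small, then the accepted
set is small. -/
theorem card_walkAccepts_le [Fintype Λ] (hR : ∀ a, ¬ Relation.TransGen R a a)
    (hk : ∀ a z p, S a → T z → IsWalk R a p z →
      ∀ v, (p.map fun c => (lit c).1).count v ≤ k)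
    (hL : k * Fintype.card ι < L * (M + 1))
    (hM : 8 * (2 ^ k * (k * (M + 1))) ≤ Fintype.card ι) {s D : ℕ}
    (hs : 2 ^ (k + 2) * s ≤ Fintype.card ι)
    (hD : ∀ (Q : Finset (ι → β)) (A B : Finset ι), (∀ x ∈ Q, WalkAccepts R lit S T x) →
      Disjoint A B → s ≤ A.card → s ≤ B.card → IsRectangle Q A B → Q.card ≤ D) :
    (Finset.univ.filter fun x => WalkAccepts R lit S T x).card ≤
      (Fintype.card Λ ^ 2 + 1) ^ L * D := by
  have hsub : (Finset.univ.filter fun x => WalkAccepts R lit S T x) ⊆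
      (Finset.univ : Finset (Fin L → Option (Λ × Λ))).biUnion (traceInputs R lit S T M L) := by
    intro x hx
    obtain ⟨f, hf⟩ := exists_mem_traceInputs hR hk hL (Finset.mem_filter.1 hx).2
    exact Finset.mem_biUnion.2 ⟨f, Finset.mem_univ _, hf⟩
  refine (Finset.card_le_card hsub).trans ((Finset.card_biUnion_le_card_mul _ _ D ?_).trans ?_)
  · intro f _
    rcases Finset.eq_empty_or_nonempty (traceInputs R lit S T M L f) with h | h
    · simp [h]
    · obtain ⟨A, B, hAB, hA, hB, hQ⟩ := exists_isRectangle_traceInputs hk hM hs f h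
      exact hD _ A B (fun x hx => walkAccepts_of_mem_traceInputs hx) hAB hA hB hQ
  · simp [sq]

end Cover

/-! ### Rectangles inside linear codes -/

section Code

variable {ι W : Type*} [Fintype ι] [DecidableEq ι] [AddCommGroup W] [Module (ZMod 2) W]

/-- The linear map `x ↦ ∑ v ∈ A, x v • h v`. -/
noncomputable def partialCheck (h : ι → W) (A : Finset ι) : (ι → ZMod 2) →ₗ[ZMod 2] W :=
  ∑ v ∈ A, (LinearMap.proj v).smulRight (h v)

omit [Fintype ι] [DecidableEq ι] in
@[simp]
theorem partialCheck_apply (h : ι → W) (A : Finset ι) (x : ι → ZMod 2) :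
    partialCheck h A x = ∑ v ∈ A, x v • h v := by
  simp [partialCheck]

omit [DecidableEq ι] in
theorem two_pow_card_le_card_ker_partialCheck [Finite W] (h : ι → W) {r : ℕ}
    (hr : Module.finrank (ZMod 2) W ≤ r) :
    2 ^ Fintype.card ι ≤ 2 ^ r * Nat.card (LinearMap.ker (partialCheck h Finset.univ)) := by
  have h1 := LinearMap.finrank_range_add_finrank_ker (partialCheck h Finset.univ)
  have h2 := Submodule.finrank_le (LinearMap.range (partialCheck h Finset.univ))
  rw [Module.natCard_eq_pow_finrank (K := ZMod 2), Nat.card_zmod, ← pow_add]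
  rw [Module.finrank_fintype_fun_eq_card] at h1
  exact Nat.pow_le_pow_right (by norm_num) (by lia)

/-- The exchanged input and `y` are both codewords and differ only on `A`; their difference isolates
the contribution of `A`. -/
theorem IsRectangle.partialCheck_sub_eq_zero {h : ι → W} {Q : Finset (ι → ZMod 2)}
    {A B : Finset ι} (hQ : IsRectangle Q A B) (hcode : ∀ x ∈ Q, ∑ v, x v • h v = 0)
    {x y : ι → ZMod 2} (hx : x ∈ Q) (hy : y ∈ Q) (hxy : ∀ v, v ∉ A → v ∉ B → x v = y v) :
    ∑ v ∈ A, (x v - y v) • h v = 0 := by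
  have hz := hcode _ (hQ x hx y hy hxy)
  have hy0 := hcode y hy
  have : ∑ v, (A.piecewise x y v - y v) • h v = 0 := by
    simp_rw [sub_smul, Finset.sum_sub_distrib]
    rw [hz, hy0, sub_zero]
  rw [← this, ← Finset.sum_subset (Finset.subset_univ A)]
  · exact Finset.sum_congr rfl fun v hv => by rw [Finset.piecewise_eq_of_mem _ _ _ hv]
  · intro v _ hv
    rw [Finset.piecewise_eq_of_notMem _ _ _ hv, sub_self, zero_smul]

omit [Fintype ι] in
theorem IsRectangle.symm {β : Type*} {Q : Finset (ι → β)} {A B : Finset ι} (hAB : Disjoint A B)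
    (hQ : IsRectangle Q A B) : IsRectangle Q B A := by
  intro x hx y hy hxy
  convert hQ y hy x hx fun v hA hB => (hxy v hB hA).symm using 1
  ext v
  by_cases hA : v ∈ A
  · have hB : v ∉ B := Finset.disjoint_left.1 hAB hA
    simp [hA, hB]
  · by_cases hB : v ∈ B
    · simp [hA, hB]
    · simp [hA, hB, hxy v hB hA]

/-- A rectangle in the code with the parity check columns `h v` is small, if the columns of both
of its sides have large rank. -/
theorem IsRectangle.card_le [Finite W] {h : ι → W} {Q : Finset (ι → ZMod 2)} {A B : Finset ι}
    (hQ : IsRectangle Q A B) (hAB : Disjoint A B) (hcode : ∀ x ∈ Q, ∑ v, x v • h v = 0) {ρ : ℕ}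
    (hA : ρ ≤ Module.finrank (ZMod 2) (Submodule.span (ZMod 2) (h '' A)))
    (hB : ρ ≤ Module.finrank (ZMod 2) (Submodule.span (ZMod 2) (h '' B))) :
    2 ^ (2 * ρ) * Q.card ≤ 2 ^ Fintype.card ι := by
  classical
  set Φ : (ι → ZMod 2) →ₗ[ZMod 2] W × W := (partialCheck h A).prod (partialCheck h B) with hΦ
  have hΦ' : ∀ x, Φ x = (partialCheck h A x, partialCheck h B x) := fun _ => rfl
  have hker : Q.card ≤ Nat.card (LinearMap.ker Φ) := by
    -- Fix one representative in `Q` for each pattern outside `A ∪ B` and subtract it on `A ∪ B`.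
    -- This maps `Q` injectively into the kernel of `Φ`.
    let c : (ι → ZMod 2) → ι → ZMod 2 := fun x v => if v ∈ A ∨ v ∈ B then 0 else x v
    let rep : (ι → ZMod 2) → ι → ZMod 2 := fun u =>
      if hu : ∃ y ∈ Q, c y = u then hu.choose else 0
    have hrep : ∀ x ∈ Q, rep (c x) ∈ Q ∧ c (rep (c x)) = c x := by
      intro x hx
      have hu : ∃ y ∈ Q, c y = c x := ⟨x, hx, rfl⟩
      simp only [rep, hu, dif_pos]
      exact hu.choose_spec
    have hagree : ∀ x ∈ Q, ∀ v, v ∉ A → v ∉ B → x v = rep (c x) v := by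
      intro x hx v hvA hvB
      have := congrFun (hrep x hx).2 v
      simp only [c, hvA, hvB, or_self, if_false] at this
      exact this.symm
    let φ : (ι → ZMod 2) → ι → ZMod 2 := fun x v =>
      if v ∈ A ∨ v ∈ B then x v - rep (c x) v else x v
    have hmaps : ∀ x ∈ Q, φ x ∈ (LinearMap.ker Φ : Set (ι → ZMod 2)) := by
      intro x hx
      rw [SetLike.mem_coe, LinearMap.mem_ker]
      refine Prod.ext ?_ ?_
      · rw [hΦ', partialCheck_apply, Prod.fst_zero]
        rw [← hQ.partialCheck_sub_eq_zero hcode hx (hrep x hx).1 (hagree x hx)]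
        exact Finset.sum_congr rfl fun v hv => by simp [φ, hv]
      · simp only [hΦ', partialCheck_apply, Prod.snd_zero]
        rw [← (hQ.symm hAB).partialCheck_sub_eq_zero hcode hx (hrep x hx).1
          fun v hvB hvA => hagree x hx v hvA hvB]
        exact Finset.sum_congr rfl fun v hv => by simp [φ, hv]
    have hinj : Set.InjOn φ Q := by
      intro x hx y hy hxy
      have hc : c x = c y := by
        ext v
        have := congrFun hxy v
        by_cases hv : v ∈ A ∨ v ∈ B
        · simp [c, hv]
        · simpa [c, φ, hv] using this
      ext v
      have := congrFun hxy v
      by_cases hv : v ∈ A ∨ v ∈ B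
      · simp only [φ, hv, if_true, hc] at this
        exact sub_left_injective this
      · simpa [φ, hv] using this
    have := Set.ncard_le_ncard_of_injOn φ hmaps hinj (Set.toFinite _)
    rwa [Set.ncard_coe_finset] at this
  set U := Submodule.span (ZMod 2) (h '' A)
  set U' := Submodule.span (ZMod 2) (h '' B)
  -- Disjointness lets the checks on `A` and on `B` take values independently, so the rank of `Φ` is
  -- at least the sum of both ranks.
  have hrange : LinearMap.range (U.subtype.prodMap U'.subtype) ≤ LinearMap.range Φ := by
    have hspan : ∀ (C D : Finset ι), Disjoint C D → ∀ u ∈ Submodule.span (ZMod 2) (h '' C),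
        ∃ x, partialCheck h C x = u ∧ partialCheck h D x = 0 := by
      intro C D hCD u hu
      induction hu using Submodule.span_induction with
      | mem u hu =>
        obtain ⟨v, hv, rfl⟩ := hu
        rw [Finset.mem_coe] at hv
        refine ⟨Pi.single v 1, ?_, ?_⟩
        · simp [Pi.single_apply, hv]
        · have : v ∉ D := Finset.disjoint_left.1 hCD hv
          simp [Pi.single_apply, this]
      | zero => exact ⟨0, by simp, by simp⟩
      | add u u' _ _ hu hu' =>
        obtain ⟨x, hx, hx'⟩ := hu
        obtain ⟨y, hy, hy'⟩ := hu'
        exact ⟨x + y, by rw [map_add, hx, hy], by rw [map_add, hx', hy', add_zero]⟩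
      | smul a u _ hu =>
        obtain ⟨x, hx, hx'⟩ := hu
        exact ⟨a • x, by rw [map_smul, hx], by rw [map_smul, hx', smul_zero]⟩
    rintro _ ⟨⟨⟨u, hu⟩, ⟨u', hu'⟩⟩, rfl⟩
    obtain ⟨x, hx, hx'⟩ := hspan A B hAB u hu
    obtain ⟨y, hy, hy'⟩ := hspan B A hAB.symm u' hu'
    refine ⟨x + y, ?_⟩
    change Φ (x + y) = (u, u')
    rw [map_add, hΦ', hΦ', hx, hy, hx', hy', Prod.mk_add_mk, add_zero, zero_add]
  have h1 := LinearMap.finrank_range_add_finrank_ker Φ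
  have h2 := Submodule.finrank_mono hrange
  rw [Module.finrank_fintype_fun_eq_card] at h1
  rw [LinearMap.finrank_range_of_inj (Function.Injective.prodMap U.injective_subtype
    U'.injective_subtype), Module.finrank_prod] at h2
  rw [Module.natCard_eq_pow_finrank (K := ZMod 2), Nat.card_zmod] at hker
  calc 2 ^ (2 * ρ) * Q.card ≤ 2 ^ (2 * ρ) * 2 ^ Module.finrank (ZMod 2) (LinearMap.ker Φ) :=
        Nat.mul_le_mul_left _ hker
    _ ≤ 2 ^ Fintype.card ι := by
        rw [← pow_add]
        exact Nat.pow_le_pow_right (by norm_num) (by lia)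

end Code

/-! ### Random sparse columns and their rank -/

section SparseColumn

/-- A sum of unit vectors, some of which are switched off. -/
def sparseColumn {r w : ℕ} (c : Fin w → Fin r × Bool) : Fin r → ZMod 2 :=
  ∑ l, if (c l).2 then Pi.single (c l).1 1 else 0

theorem card_support_sparseColumn_le {r w : ℕ} (c : Fin w → Fin r × Bool) :
    (Finset.univ.filter fun j => sparseColumn c j ≠ 0).card ≤ w := by
  have h : (Finset.univ.filter fun j => sparseColumn c j ≠ 0) ⊆
      Finset.univ.image fun l => (c l).1 := by
    intro j hj
    rw [Finset.mem_filter] at hj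
    by_contra hcon
    refine hj.2 ?_
    rw [sparseColumn, Finset.sum_apply]
    refine Finset.sum_eq_zero fun l _ => ?_
    have : (c l).1 ≠ j := fun h => hcon (Finset.mem_image.2 ⟨l, Finset.mem_univ _, h⟩)
    split_ifs
    · rw [Pi.single_eq_of_ne this.symm]
    · rfl
  exact (Finset.card_le_card h).trans (Finset.card_image_le.trans (by simp))

open Classical in
theorem card_unit_mem_le_finrank {r : ℕ} (U : Submodule (ZMod 2) (Fin r → ZMod 2)) :
    (Finset.univ.filter fun i : Fin r => (Pi.single i 1 : Fin r → ZMod 2) ∈ U).card ≤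
      Module.finrank (ZMod 2) U := by
  set F := Finset.univ.filter fun i : Fin r => (Pi.single i 1 : Fin r → ZMod 2) ∈ U with hF
  have hli : LinearIndependent (ZMod 2)
      (fun i : F => (⟨Pi.single i.1 1, (Finset.mem_filter.1 i.2).2⟩ : U)) := by
    refine LinearIndependent.of_comp U.subtype ?_
    have := (Pi.basisFun (ZMod 2) (Fin r)).linearIndependent.comp (fun i : F => i.1)
      Subtype.val_injective
    convert this using 1
    ext i
    simp
  simpa using hli.fintype_card_le_finrank

open Classical in
/-- Few sparse columns lie in a given subspace of small dimension. -/
theorem card_sparseColumn_mem_le {r w d : ℕ} (U : Submodule (ZMod 2) (Fin r → ZMod 2))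
    (hU : Module.finrank (ZMod 2) U + w ≤ d) :
    (Finset.univ.filter fun c : Fin w → Fin r × Bool => sparseColumn c ∈ U).card ≤
      (r + d) ^ w := by
  induction w generalizing U with
  | zero => exact (Finset.card_le_univ _).trans (by simp)
  | succ w ih =>
    have hcons : ∀ (γ : Fin r × Bool) (c : Fin w → Fin r × Bool),
        sparseColumn (Fin.cons γ c : Fin (w + 1) → Fin r × Bool) =
          (if γ.2 then Pi.single γ.1 1 else 0) + sparseColumn c := by
      intro γ c
      simp [sparseColumn, Fin.sum_univ_succ]
    have h1 : (Finset.univ.filter fun c : Fin (w + 1) → Fin r × Bool => sparseColumn c ∈ U).card =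
        ∑ i : Fin r, ((Finset.univ.filter fun c : Fin w → Fin r × Bool =>
            Pi.single i 1 + sparseColumn c ∈ U).card +
          (Finset.univ.filter fun c : Fin w → Fin r × Bool => sparseColumn c ∈ U).card) := by
      simp_rw [Finset.card_filter]
      rw [← (Fin.consEquiv fun _ => Fin r × Bool).sum_comp, Fintype.sum_prod_type,
        Fintype.sum_prod_type]
      refine Finset.sum_congr rfl fun i _ => ?_
      rw [Fintype.sum_bool]
      simp [Fin.consEquiv, hcons]
    -- If the unit vector `i` lies in `U`, both counts are the count for `U`. Otherwise the two
    -- events are disjoint and imply membership in `U` enlarged by that vector. The first case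
    -- occurs for at most `finrank U` indices, so each slot costs a factor `r + d` instead of `2 *
    -- r`.
    have h2 : ∀ i : Fin r, (Finset.univ.filter fun c : Fin w → Fin r × Bool =>
            Pi.single i 1 + sparseColumn c ∈ U).card +
          (Finset.univ.filter fun c : Fin w → Fin r × Bool => sparseColumn c ∈ U).card ≤
        (if (Pi.single i 1 : Fin r → ZMod 2) ∈ U then 1 else 0) * (r + d) ^ w + (r + d) ^ w := by
      intro i
      split_ifs with hi
      · have := ih U (by lia)
        simp_rw [Submodule.add_mem_iff_right U hi]
        lia
      · rw [← Finset.card_union_of_disjoint]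
        · rw [zero_mul, zero_add]
          refine le_trans (Finset.card_le_card ?_)
            (ih (U ⊔ Submodule.span (ZMod 2) {Pi.single i 1}) ?_)
          · intro c hc
            simp only [Finset.mem_union, Finset.mem_filter, Finset.mem_univ, true_and] at hc ⊢
            rcases hc with hc | hc
            · have h3 : (Pi.single i 1 : Fin r → ZMod 2) ∈
                  U ⊔ Submodule.span (ZMod 2) {(Pi.single i 1 : Fin r → ZMod 2)} :=
                Submodule.mem_sup_right (Submodule.mem_span_singleton_self _)
              exact (Submodule.add_mem_iff_right _ h3).1 (Submodule.mem_sup_left hc)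
            · exact Submodule.mem_sup_left hc
          · have h3 := Submodule.finrank_add_le_finrank_add_finrank U
              (Submodule.span (ZMod 2) {(Pi.single i 1 : Fin r → ZMod 2)})
            have h4 := finrank_span_le_card (R := ZMod 2) {(Pi.single i 1 : Fin r → ZMod 2)}
            rw [Set.toFinset_singleton, Finset.card_singleton] at h4
            lia
        · rw [Finset.disjoint_filter]
          intro c _ hc hc'
          exact hi ((Submodule.add_mem_iff_left U hc').1 hc)
    rw [h1]
    refine (Finset.sum_le_sum fun i _ => h2 i).trans ?_
    rw [Finset.sum_add_distrib, ← Finset.sum_mul, ← Finset.card_filter, Finset.sum_const,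
      Finset.card_univ, Fintype.card_fin, smul_eq_mul, ← add_mul, pow_succ', add_comm r]
    refine Nat.mul_le_mul_right _ ?_
    have := card_unit_mem_le_finrank U
    lia

end SparseColumn

section Expansion

variable {ι Γ W : Type*} [Fintype ι] [DecidableEq ι] [Fintype Γ]
  [AddCommGroup W] [Module (ZMod 2) W]

omit [Fintype ι] [DecidableEq ι] in
-- A basis chosen among the columns is padded to exactly `ρ` elements, so that the later union bound
-- has fixed exponents.
theorem exists_subset_card_eq_span_eq [Finite W] (h : ι → W) {A : Finset ι} {ρ : ℕ}
    (hA : ρ ≤ A.card) (hr : Module.finrank (ZMod 2) (Submodule.span (ZMod 2) (h '' A)) ≤ ρ) :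
    ∃ S ⊆ A, S.card = ρ ∧ ∀ v ∈ A, h v ∈ Submodule.span (ZMod 2) (h '' S) := by
  classical
  obtain ⟨b, hb, hspan, hli⟩ := exists_linearIndependent (ZMod 2) (h '' (A : Set ι))
  have hsurj : Set.SurjOn h A b := hb
  obtain ⟨S, hSA, hbij⟩ := hsurj.exists_bijOn_subset
  have hSfin : S.Finite := A.finite_toSet.subset hSA
  lift S to Finset ι using hSfin
  have hcard : S.card ≤ ρ := by
    have h1 : Module.finrank (ZMod 2) (Submodule.span (ZMod 2) b) = b.ncard := by
      have : Fintype b := Fintype.ofFinite b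
      rw [finrank_span_set_eq_card hli, Set.ncard_eq_toFinset_card']
    rw [← hspan, h1, ← hbij.image_eq, hbij.injOn.ncard_image,
      Set.ncard_coe_finset] at hr
    exact hr
  obtain ⟨S', hSS', hS'A, hS'⟩ := Finset.exists_subsuperset_card_eq
    (Finset.coe_subset.1 hSA) hcard hA
  refine ⟨S', hS'A, hS', fun v hv => ?_⟩
  have h1 : h v ∈ Submodule.span (ZMod 2) b := by
    rw [hspan]
    exact Submodule.subset_span ⟨v, hv, rfl⟩
  refine Submodule.span_mono ?_ h1
  rw [← hbij.image_eq]
  exact Set.image_mono (Finset.coe_subset.2 hSS')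

omit [AddCommGroup W] [Module (ZMod 2) W] in
open Classical in
-- The condition `P` ignores the coordinates in `D`. Once the others are fixed, each coordinate in
-- `D` has at most `q` choices.
theorem card_choices_le (D : Finset ι) (P : (ι → Γ) → Γ → Prop) {q : ℕ}
    (hP : ∀ ω ω', (∀ v ∉ D, ω v = ω' v) → ∀ γ, P ω γ → P ω' γ)
    (hq : ∀ ω, (Finset.univ.filter fun γ => P ω γ).card ≤ q) :
    (Finset.univ.filter fun ω : ι → Γ => ∀ v ∈ D, P ω (ω v)).card ≤
      q ^ D.card * Fintype.card Γ ^ (Fintype.card ι - D.card) := by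
  set Ω := Finset.univ.filter fun ω : ι → Γ => ∀ v ∈ D, P ω (ω v) with hΩ
  let π : (ι → Γ) → ({v // v ∉ D} → Γ) := fun ω v => ω v.1
  have h1 : Ω.card ≤ q ^ D.card * (Ω.image π).card := by
    refine Finset.card_le_mul_card_image _ _ fun b hb => ?_
    obtain ⟨ω₀, hω₀, rfl⟩ := Finset.mem_image.1 hb
    have hmaps : ∀ ω ∈ Ω.filter (fun ω => π ω = π ω₀), (fun v : D => ω v.1) ∈
        Fintype.piFinset fun _ : D => Finset.univ.filter fun γ => P ω₀ γ := by
      intro ω hω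
      obtain ⟨hω1, hω2⟩ := Finset.mem_filter.1 hω
      rw [Fintype.mem_piFinset]
      intro v
      refine Finset.mem_filter.2 ⟨Finset.mem_univ _, ?_⟩
      exact hP ω ω₀ (fun u hu => congrFun hω2 ⟨u, hu⟩) _ ((Finset.mem_filter.1 hω1).2 _ v.2)
    have hinj : Set.InjOn (fun (ω : ι → Γ) (v : D) => ω v.1)
        (Ω.filter (fun ω => π ω = π ω₀) : Set (ι → Γ)) := by
      intro ω hω ω' hω' h
      have hω2 := (Finset.mem_filter.1 hω).2
      have hω2' := (Finset.mem_filter.1 hω').2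
      ext v
      by_cases hv : v ∈ D
      · exact congrFun h ⟨v, hv⟩
      · exact congrFun (hω2.trans hω2'.symm) ⟨v, hv⟩
    refine (Finset.card_le_card_of_injOn _ hmaps hinj).trans ?_
    rw [Fintype.card_piFinset, Finset.prod_const, Finset.card_univ, Fintype.card_coe]
    exact Nat.pow_le_pow_left (hq ω₀) _
  refine h1.trans (Nat.mul_le_mul_left _ ((Finset.card_le_univ _).trans ?_))
  rw [Fintype.card_fun, Fintype.card_subtype_compl, Fintype.card_coe]

open Classical in
/-- If few elements of `Γ` are mapped into any given subspace of small dimension, then some family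
of elements has the property that all large subfamilies have large rank. -/
theorem exists_family_finrank_le [Finite W] [Nonempty Γ] (g : Γ → W) {ρ a q : ℕ}
    (hq : ∀ U : Submodule (ZMod 2) W, Module.finrank (ZMod 2) U ≤ ρ →
      (Finset.univ.filter fun γ => g γ ∈ U).card ≤ q)
    (hρ : ρ ≤ a) (ha : a ≤ Fintype.card ι)
    (hlt : (Fintype.card ι).choose a * 2 ^ a * q ^ (a - ρ) < Fintype.card Γ ^ (a - ρ)) :
    ∃ ω : ι → Γ, ∀ A : Finset ι, a ≤ A.card →
      ρ ≤ Module.finrank (ZMod 2) (Submodule.span (ZMod 2) ((g ∘ ω) '' A)) := by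
  by_contra! hcon
  set t := Fintype.card ι with ht
  -- Union bound over a bad set `A` of size `a` and a subset `S` of size `ρ` spanning it; the other
  -- `a - ρ` columns are forced into the span of `S`.
  let I : Finset ((_ : Finset ι) × Finset ι) :=
    (Finset.powersetCard a Finset.univ).sigma fun A => Finset.powersetCard ρ A
  let P : Finset ι → (ι → Γ) → Γ → Prop := fun S ω γ =>
    g γ ∈ Submodule.span (ZMod 2) ((g ∘ ω) '' S)
  have hcover : (Finset.univ : Finset (ι → Γ)) ⊆ I.biUnion fun AS =>
      Finset.univ.filter fun ω => ∀ v ∈ AS.1 \ AS.2, P AS.2 ω (ω v) := by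
    intro ω _
    obtain ⟨A, hA, hrank⟩ := hcon ω
    obtain ⟨A', hA'A, hA'⟩ := Finset.exists_subset_card_eq hA
    have hrank' : Module.finrank (ZMod 2) (Submodule.span (ZMod 2) ((g ∘ ω) '' A')) ≤ ρ :=
      (Submodule.finrank_mono (Submodule.span_mono
        (Set.image_mono (Finset.coe_subset.2 hA'A)))).trans hrank.le
    obtain ⟨S, hSA, hS, hmem⟩ := exists_subset_card_eq_span_eq (g ∘ ω) (hρ.trans hA'.ge) hrank'
    refine Finset.mem_biUnion.2 ⟨⟨A', S⟩, ?_, ?_⟩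
    · exact Finset.mem_sigma.2 ⟨Finset.mem_powersetCard.2 ⟨Finset.subset_univ _, hA'⟩,
        Finset.mem_powersetCard.2 ⟨hSA, hS⟩⟩
    · exact Finset.mem_filter.2 ⟨Finset.mem_univ _,
        fun v hv => hmem v (Finset.mem_sdiff.1 hv).1⟩
  have hI : I.card ≤ t.choose a * 2 ^ a := by
    rw [Finset.card_sigma]
    calc _ ≤ ∑ A ∈ Finset.powersetCard a (Finset.univ : Finset ι), 2 ^ a := by
          refine Finset.sum_le_sum fun A hA => ?_
          rw [Finset.card_powersetCard, (Finset.mem_powersetCard.1 hA).2]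
          exact Nat.choose_le_two_pow a ρ
      _ = _ := by rw [Finset.sum_const, Finset.card_powersetCard, Finset.card_univ, smul_eq_mul]
  have hcard : Fintype.card Γ ^ t ≤
      (t.choose a * 2 ^ a) * (q ^ (a - ρ) * Fintype.card Γ ^ (t - (a - ρ))) := by
    have h1 := (Finset.card_le_card hcover).trans (Finset.card_biUnion_le_card_mul _ _
      (q ^ (a - ρ) * Fintype.card Γ ^ (t - (a - ρ))) ?_)
    · rw [Finset.card_univ, Fintype.card_fun] at h1
      exact h1.trans (Nat.mul_le_mul_right _ hI)
    · rintro ⟨A, S⟩ hAS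
      obtain ⟨hA, hS⟩ := Finset.mem_sigma.1 hAS
      obtain ⟨-, hA⟩ := Finset.mem_powersetCard.1 hA
      obtain ⟨hSA, hS⟩ := Finset.mem_powersetCard.1 hS
      simp only at hA hSA hS
      have hD : (A \ S).card = a - ρ := by
        rw [Finset.card_sdiff_of_subset hSA, hA, hS]
      have h2 := card_choices_le (A \ S) (P S) (q := q) ?_ ?_
      · rwa [hD] at h2
      · intro ω ω' hω γ hγ
        have : (g ∘ ω) '' (S : Set ι) = (g ∘ ω') '' S := by
          refine Set.image_congr fun v hv => ?_
          have hv' : v ∉ A \ S := fun h => (Finset.mem_sdiff.1 h).2 hv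
          simp [hω v hv']
        change g γ ∈ Submodule.span (ZMod 2) ((g ∘ ω) '' S) at hγ
        change g γ ∈ Submodule.span (ZMod 2) ((g ∘ ω') '' S)
        rwa [← this]
      · intro ω
        refine hq _ ?_
        rw [← hS]
        have := finrank_span_finset_le_card (R := ZMod 2) (S.image (g ∘ ω))
        rw [Finset.coe_image] at this
        exact this.trans Finset.card_image_le
  have hpos : 0 < Fintype.card Γ := Fintype.card_pos
  have hsplit : Fintype.card Γ ^ t = Fintype.card Γ ^ (a - ρ) * Fintype.card Γ ^ (t - (a - ρ)) := by
    rw [← pow_add]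
    congr 1
    lia
  rw [hsplit, ← mul_assoc] at hcard
  exact absurd (Nat.le_of_mul_le_mul_right hcard (by positivity)) (not_le.2 hlt)

end Expansion

/-! ### Evaluating parity checks by a multiplication table -/

/-- One step of the evaluation of parity checks: `some v` adds `x v` to the current parity, `none`
aborts unless the current parity is zero. -/
def checkStep {t : ℕ} (x : Fin t → ZMod 2) : Option (ZMod 2) → Option (Fin t) → Option (ZMod 2)
  | some s, some v => some (s + x v)
  | some s, none => if s = 0 then some 0 else none
  | none, _ => none

/-- The state after a list of steps, started with parity zero. -/
def checkRun {t : ℕ} (x : Fin t → ZMod 2) (l : List (Option (Fin t))) : Option (ZMod 2) :=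
  l.foldl (checkStep x) (some 0)

namespace GENEmbedding

variable {t m : ℕ}

/-- The element that stands for the value `c` of the variable `v`. -/
def litElt (t v : ℕ) (c : ZMod 2) : ℕ := 2 * (t + 1) + 2 * v + c.val

/-- The element that stands for parity `s` at time `i`. -/
def stateElt (t i : ℕ) (s : ZMod 2) : ℕ := 2 * (t + 1) + 2 * t + 2 * i + s.val

theorem val_lt_two (s : ZMod 2) : s.val < 2 := ZMod.val_lt s

/-- The products that do not depend on the input. -/
def FixedRule (t m : ℕ) (ops : List (Option (Fin t))) (i j l : ℕ) : Prop :=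
  (i = 0 ∧ j < t ∧ l = j + 1) ∨
  (i = 0 ∧ j = t ∧ l = stateElt t 0 0) ∨
  (∃ (τ : ℕ) (v : Fin t) (s c : ZMod 2), ops[τ]? = some (some v) ∧ i = litElt t v c ∧
    j = stateElt t τ s ∧ l = stateElt t (τ + 1) (s + c)) ∨
  (∃ τ : ℕ, ops[τ]? = some none ∧ i = 0 ∧ j = stateElt t τ 0 ∧ l = stateElt t (τ + 1) 0) ∨
  (i = 0 ∧ j = stateElt t ops.length 0 ∧ l = m - 1)

theorem litElt_inj {v v' : ℕ} {c c' : ZMod 2} (h : litElt t v c = litElt t v' c') :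
    v = v' ∧ c = c' := by
  unfold litElt at h
  have h1 := val_lt_two c
  have h2 := val_lt_two c'
  exact ⟨by lia, ZMod.val_injective 2 (by lia)⟩

theorem stateElt_inj {v v' : ℕ} {c c' : ZMod 2} (h : stateElt t v c = stateElt t v' c') :
    v = v' ∧ c = c' := by
  unfold stateElt at h
  have h1 := val_lt_two c
  have h2 := val_lt_two c'
  exact ⟨by lia, ZMod.val_injective 2 (by lia)⟩

theorem lt_length_of_getElem?_eq {α : Type*} {l : List α} {i : ℕ} {a : α} (h : l[i]? = some a) :
    i < l.length :=
  (List.getElem?_eq_some_iff.1 h).1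

theorem lt_litElt (v : ℕ) (c : ZMod 2) : 2 * t + 1 < litElt t v c := by
  unfold litElt
  lia

theorem litElt_lt (v : Fin t) (c : ZMod 2) : litElt t v c < 2 * (t + 1) + 2 * t := by
  unfold litElt
  have h1 := val_lt_two c
  lia

theorem le_stateElt (i : ℕ) (c : ZMod 2) : 2 * (t + 1) + 2 * t ≤ stateElt t i c := by
  unfold stateElt
  lia

theorem stateElt_lt {i n : ℕ} (c : ZMod 2) (hi : i ≤ n) :
    stateElt t i c < 2 * (t + 1) + 2 * t + 2 * n + 2 := by
  unfold stateElt
  have h1 := val_lt_two c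
  lia

/-- Constants are at most `t`, literals lie in `[2t + 2, 4t + 2)` and states lie above, so factors
of different kinds never coincide. A test and the final rule both multiply a state by `0`, but at
times before `ops.length` and at `ops.length` respectively. -/
theorem FixedRule.unique {ops : List (Option (Fin t))} {i j l l' : ℕ}
    (h : FixedRule t m ops i j l) (h' : FixedRule t m ops i j l') : l = l' := by
  rcases h with ⟨hi, hj, hl⟩ | ⟨hi, hj, hl⟩ | ⟨τ, v, s, c, ho, hi, hj, hl⟩ | ⟨τ, ho, hi, hj, hl⟩ |
    ⟨hi, hj, hl⟩ <;>
  rcases h' with ⟨hi', hj', hl'⟩ | ⟨hi', hj', hl'⟩ | ⟨τ', v', s', c', ho', hi', hj', hl'⟩ |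
    ⟨τ', ho', hi', hj', hl'⟩ | ⟨hi', hj', hl'⟩
  · lia
  · lia
  · have := lt_litElt (t := t) v' c'; lia
  · have := le_stateElt (t := t) τ' 0; lia
  · have := le_stateElt (t := t) ops.length 0; lia
  · lia
  · lia
  · have := lt_litElt (t := t) v' c'; lia
  · have := le_stateElt (t := t) τ' 0; lia
  · have := le_stateElt (t := t) ops.length 0; lia
  · have := lt_litElt (t := t) v c; lia
  · have := lt_litElt (t := t) v c; lia
  · obtain ⟨h1, h2⟩ := litElt_inj (hi.symm.trans hi')
    obtain ⟨h3, h4⟩ := stateElt_inj (hj.symm.trans hj')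
    rw [hl, hl', h2, h3, h4]
  · have := lt_litElt (t := t) v c; lia
  · have := lt_litElt (t := t) v c; lia
  · have := le_stateElt (t := t) τ 0; lia
  · have := le_stateElt (t := t) τ 0; lia
  · have := lt_litElt (t := t) v' c'; lia
  · rw [hl, hl', (stateElt_inj (hj.symm.trans hj')).1]
  · have := lt_length_of_getElem?_eq ho
    have := (stateElt_inj (hj.symm.trans hj')).1
    lia
  · have := le_stateElt (t := t) ops.length 0; lia
  · have := le_stateElt (t := t) ops.length 0; lia
  · have := lt_litElt (t := t) v' c'; lia
  · have := lt_length_of_getElem?_eq ho'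
    have := (stateElt_inj (hj.symm.trans hj')).1
    lia
  · lia

theorem FixedRule.lt {ops : List (Option (Fin t))} (hm : 4 * t + 2 * ops.length + 5 ≤ m)
    {i j l : ℕ} (h : FixedRule t m ops i j l) : l < m := by
  rcases h with ⟨hi, hj, hl⟩ | ⟨hi, hj, hl⟩ | ⟨τ, v, s, c, ho, hi, hj, hl⟩ | ⟨τ, ho, hi, hj, hl⟩ |
    ⟨hi, hj, hl⟩
  · lia
  · have := stateElt_lt (t := t) 0 (Nat.zero_le ops.length); lia
  · have := stateElt_lt (t := t) (s + c) (lt_length_of_getElem?_eq ho); lia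
  · have := stateElt_lt (t := t) 0 (lt_length_of_getElem?_eq ho); lia
  · lia

theorem FixedRule.not_switch {ops : List (Option (Fin t))} {i j l : ℕ}
    (h : FixedRule t m ops i j l) (v : Fin t) : ¬ (i = v + 1 ∧ j = v + 1) := by
  rintro ⟨h1, h2⟩
  rcases h with ⟨hi, hj, hl⟩ | ⟨hi, hj, hl⟩ | ⟨τ, v', s, c, ho, hi, hj, hl⟩ | ⟨τ, ho, hi, hj, hl⟩ |
    ⟨hi, hj, hl⟩
  · lia
  · lia
  · have := lt_litElt (t := t) v' c; lia
  · lia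
  · lia

open Classical in
/-- The product of `i` and `j` in the table for the input `x`. -/
noncomputable def entry (m : ℕ) (ops : List (Option (Fin t))) (x : Fin t → ZMod 2) (i j : ℕ) : ℕ :=
  if h : ∃ v : Fin t, i = v + 1 ∧ j = v + 1 then litElt t h.choose (x h.choose)
  else if h : ∃ l, FixedRule t m ops i j l then h.choose else 0

variable {ops : List (Option (Fin t))} {x : Fin t → ZMod 2}

theorem entry_switch (v : Fin t) : entry m ops x (v + 1) (v + 1) = litElt t v (x v) := by
  have h : ∃ u : Fin t, v.1 + 1 = u + 1 ∧ v.1 + 1 = u + 1 := ⟨v, rfl, rfl⟩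
  have h' : h.choose = v := Fin.ext (by have := h.choose_spec.1; lia)
  rw [entry, dif_pos h, h']

theorem entry_of_fixedRule {i j l : ℕ} (h : FixedRule t m ops i j l) : entry m ops x i j = l := by
  rw [entry, dif_neg (fun ⟨v, hv⟩ => h.not_switch v hv), dif_pos ⟨l, h⟩]
  exact FixedRule.unique (Exists.choose_spec (⟨l, h⟩ : ∃ l, FixedRule t m ops i j l)) h

theorem entry_cases (i j : ℕ) :
    (∃ v : Fin t, i = v + 1 ∧ j = v + 1 ∧ entry m ops x i j = litElt t v (x v)) ∨
    FixedRule t m ops i j (entry m ops x i j) ∨ entry m ops x i j = 0 := by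
  by_cases h : ∃ v : Fin t, i = v + 1 ∧ j = v + 1
  · obtain ⟨v, rfl, rfl⟩ := h
    exact Or.inl ⟨v, rfl, rfl, entry_switch v⟩
  · by_cases h' : ∃ l, FixedRule t m ops i j l
    · obtain ⟨l, hl⟩ := h'
      right; left
      rwa [entry_of_fixedRule hl]
    · right; right
      rw [entry, dif_neg h, dif_neg h']

theorem entry_eq_of_not_switch (x' : Fin t → ZMod 2) {i j : ℕ}
    (h : ¬ ∃ v : Fin t, i = v + 1 ∧ j = v + 1) : entry m ops x i j = entry m ops x' i j := by
  rw [entry, entry, dif_neg h, dif_neg h]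

theorem entry_lt (hm : 4 * t + 2 * ops.length + 5 ≤ m) (i j : ℕ) : entry m ops x i j < m := by
  rcases entry_cases (m := m) (ops := ops) (x := x) i j with ⟨v, -, -, h⟩ | h | h
  · have := litElt_lt v (x v)
    lia
  · exact h.lt hm
  · lia

/-- The multiplication table for the input `x`. -/
noncomputable def table (hm : 4 * t + 2 * ops.length + 5 ≤ m) (x : Fin t → ZMod 2) :
    GenPair m → Fin m :=
  fun p => ⟨entry m ops x p.1.1 p.1.2, entry_lt hm _ _⟩

theorem checkRun_take_succ {τ : ℕ} {o : Option (Fin t)} (h : ops[τ]? = some o) :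
    checkRun x (ops.take (τ + 1)) = checkStep x (checkRun x (ops.take τ)) o := by
  simp [checkRun, List.take_add_one, h]

/-- The elements that are generated in the table for `x`. -/
def Inv (m : ℕ) (ops : List (Option (Fin t))) (x : Fin t → ZMod 2) (a : ℕ) : Prop :=
  a ≤ t ∨ (∃ v : Fin t, a = litElt t v (x v)) ∨
  (∃ τ s, τ ≤ ops.length ∧ a = stateElt t τ s ∧ checkRun x (ops.take τ) = some s) ∨
  (a = m - 1 ∧ checkRun x ops = some 0)

theorem inv_state (hm : 4 * t + 2 * ops.length + 5 ≤ m) {τ : ℕ} {s : ZMod 2}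
    (hτ : τ ≤ ops.length) (h : Inv m ops x (stateElt t τ s)) :
    checkRun x (ops.take τ) = some s := by
  have h1 := le_stateElt (t := t) τ s
  rcases h with h | ⟨v, h⟩ | ⟨τ', s', hτ', h, hr⟩ | ⟨h, -⟩
  · lia
  · have := litElt_lt v (x v)
    lia
  · obtain ⟨rfl, rfl⟩ := stateElt_inj h
    exact hr
  · have := stateElt_lt (t := t) s hτ
    lia

theorem inv_lit (hm : 4 * t + 2 * ops.length + 5 ≤ m) {v : Fin t} {c : ZMod 2}
    (h : Inv m ops x (litElt t v c)) : c = x v := by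
  have h1 := lt_litElt (t := t) v c
  have h2 := litElt_lt v c
  rcases h with h | ⟨v', h⟩ | ⟨τ', s', hτ', h, hr⟩ | ⟨h, -⟩
  · lia
  · obtain ⟨h3, h4⟩ := litElt_inj h
    rw [h4, Fin.ext h3]
  · have := le_stateElt (t := t) τ' s'
    lia
  · lia

/-- Soundness: only the true literal of each variable and the state actually reached at each time
can be generated, so no false run can be assembled. Entries without a rule are `0`, which is
generated anyway. -/
theorem inv_of_generated (hm : 4 * t + 2 * ops.length + 5 ≤ m) {a : Fin m}
    (h : Generated (table hm x) a) : Inv m ops x a := by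
  induction h with
  | one a ha => exact Or.inl (by lia)
  | mul p a b hap hbp _ _ iha ihb =>
    rw [hap] at iha
    rw [hbp] at ihb
    change Inv m ops x (entry m ops x p.1.1 p.1.2)
    generalize (p.1.1 : ℕ) = i at *
    generalize (p.1.2 : ℕ) = j at *
    rcases entry_cases (m := m) (ops := ops) (x := x) i j with ⟨v, -, -, h⟩ | h | h
    · exact Or.inr (Or.inl ⟨v, h⟩)
    · rcases h with ⟨hi, hj, hl⟩ | ⟨hi, hj, hl⟩ | ⟨τ, v, s, c, ho, hi, hj, hl⟩ |
        ⟨τ, ho, hi, hj, hl⟩ | ⟨hi, hj, hl⟩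
      · exact Or.inl (by lia)
      · exact Or.inr (Or.inr (Or.inl ⟨0, 0, Nat.zero_le _, hl, by simp [checkRun]⟩))
      · have hτ := lt_length_of_getElem?_eq ho
        rw [hj] at ihb
        rw [hi] at iha
        refine Or.inr (Or.inr (Or.inl ⟨τ + 1, s + c, hτ, hl, ?_⟩))
        rw [checkRun_take_succ ho, inv_state hm hτ.le ihb, inv_lit hm iha, checkStep]
      · have hτ := lt_length_of_getElem?_eq ho
        rw [hj] at ihb
        refine Or.inr (Or.inr (Or.inl ⟨τ + 1, 0, hτ, hl, ?_⟩))
        rw [checkRun_take_succ ho, inv_state hm hτ.le ihb, checkStep, if_pos rfl]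
      · rw [hj] at ihb
        refine Or.inr (Or.inr (Or.inr ⟨hl, ?_⟩))
        simpa using inv_state hm le_rfl ihb
    · exact Or.inl (by lia)

theorem generated_mul (hm : 4 * t + 2 * ops.length + 5 ≤ m) {i j l : ℕ} (hij : i ≤ j)
    (hj : j < m - 1) (hi' : ∃ h : i < m, Generated (table hm x) ⟨i, h⟩)
    (hj' : ∃ h : j < m, Generated (table hm x) ⟨j, h⟩) (hl : entry m ops x i j = l) :
    ∃ h : l < m, Generated (table hm x) ⟨l, h⟩ := by
  obtain ⟨hi1, hi2⟩ := hi'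
  obtain ⟨hj1, hj2⟩ := hj'
  have h := Generated.mul (X := table hm x) ⟨(⟨i, by lia⟩, ⟨j, hj⟩), hij⟩ _ _ rfl rfl hi2 hj2
  refine ⟨hl ▸ entry_lt hm _ _, ?_⟩
  convert h using 1
  exact Fin.ext hl.symm

theorem generated_const (hm : 4 * t + 2 * ops.length + 5 ≤ m) (i : ℕ) (hi : i ≤ t) :
    ∃ h : i < m, Generated (table hm x) ⟨i, h⟩ := by
  have h0 : ∃ h : 0 < m, Generated (table hm x) ⟨0, h⟩ := ⟨by lia, .one _ rfl⟩
  induction i with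
  | zero => exact h0
  | succ i ih =>
    exact generated_mul hm (Nat.zero_le i) (by lia) h0 (ih (by lia))
      (entry_of_fixedRule (Or.inl ⟨rfl, by lia, rfl⟩))

/-- Completeness: the true literal is the square of the constant `v + 1`, and its product with the
current state is the next state; a passed test multiplies by `0`. -/
theorem generated_state (hm : 4 * t + 2 * ops.length + 5 ≤ m) (τ : ℕ) (hτ : τ ≤ ops.length)
    (s : ZMod 2) (hs : checkRun x (ops.take τ) = some s) :
    ∃ h : stateElt t τ s < m, Generated (table hm x) ⟨stateElt t τ s, h⟩ := by
  have h0 := generated_const (x := x) hm 0 (Nat.zero_le _)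
  induction τ generalizing s with
  | zero =>
    simp only [checkRun, List.take_zero, List.foldl_nil, Option.some.injEq] at hs
    subst hs
    exact generated_mul hm (Nat.zero_le t) (by lia) h0 (generated_const hm t le_rfl)
      (entry_of_fixedRule (Or.inr (Or.inl ⟨rfl, rfl, rfl⟩)))
  | succ τ ih =>
    have ho : ops[τ]? = some ops[τ] := List.getElem?_eq_getElem hτ
    rw [checkRun_take_succ ho] at hs
    generalize ops[τ] = o at ho hs
    cases hr : checkRun x (ops.take τ) with
    | none => simp [hr, checkStep] at hs
    | some s' =>
      have hgen := ih (by lia) s' hr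
      have hlt := stateElt_lt (t := t) s' (show τ ≤ ops.length by lia)
      rw [hr] at hs
      cases o with
      | none =>
        simp only [checkStep] at hs
        split_ifs at hs with hs'
        subst hs'
        simp only [Option.some.injEq] at hs
        subst hs
        exact generated_mul hm (Nat.zero_le _) (by lia) h0 hgen
          (entry_of_fixedRule (Or.inr (Or.inr (Or.inr (Or.inl ⟨τ, ho, rfl, rfl, rfl⟩)))))
      | some v =>
        simp only [checkStep, Option.some.injEq] at hs
        subst hs
        have hv := generated_const (x := x) hm (v + 1) v.2
        have hlit : ∃ h, Generated (table hm x) ⟨litElt t v (x v), h⟩ :=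
          generated_mul hm le_rfl (by lia) hv hv (entry_switch v)
        have h1 := litElt_lt v (x v)
        have h2 := le_stateElt (t := t) τ s'
        exact generated_mul hm (by lia) (by lia) hlit hgen
          (entry_of_fixedRule (Or.inr (Or.inr (Or.inl ⟨τ, v, s', x v, ho, rfl, rfl, rfl⟩))))

theorem gen_table_iff (hm : 4 * t + 2 * ops.length + 5 ≤ m) :
    GEN (table hm x) = true ↔ checkRun x ops = some 0 := by
  simp only [GEN, decide_eq_true_eq]
  constructor
  · rintro ⟨a, ha, hgen⟩
    rcases inv_of_generated hm hgen with h | ⟨v, h⟩ | ⟨τ, s, hτ, h, -⟩ | ⟨-, h⟩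
    · lia
    · have := litElt_lt v (x v)
      lia
    · have := stateElt_lt (t := t) s hτ
      lia
    · exact h
  · intro h
    have hst := generated_state (x := x) hm ops.length le_rfl 0 (by simpa using h)
    have h0 := generated_const (x := x) hm 0 (Nat.zero_le _)
    have h1 := stateElt_lt (t := t) 0 (le_refl ops.length)
    obtain ⟨h2, h3⟩ := generated_mul hm (Nat.zero_le _) (by lia) h0 hst
      (entry_of_fixedRule (Or.inr (Or.inr (Or.inr (Or.inr ⟨rfl, rfl, rfl⟩)))))
    exact ⟨_, by simp only; lia, h3⟩

end GENEmbedding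

open GENEmbedding in
/-- Parity checks are evaluated by GEN, where each variable decides a single bit of the table. -/
theorem exists_gen_embedding {t m : ℕ} (ops : List (Option (Fin t)))
    (hm : 4 * t + 2 * ops.length + 5 ≤ m) :
    ∃ (pos : Fin t → GenVar m) (y : GenVar m → Bool),
      ∀ x : Fin t → ZMod 2, ∃ X : GenPair m → Fin m,
        (∀ v, genEncode X (pos v) = decide (x v = 1)) ∧
        (∀ u, u ∉ Set.range pos → genEncode X u = y u) ∧
        (GEN X = true ↔ checkRun x ops = some 0) := by
  have hlog : 0 < Nat.clog 2 m := Nat.clog_pos (by norm_num) (by lia)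
  have hpos : ∀ v : Fin t, v.1 + 1 < m - 1 := fun v => by lia
  -- The two literals of `v` are `2 * (t + 1 + v)` and its successor. Thus only the lowest bit of
  -- one diagonal entry depends on `x v`, and the table for `x = 0` supplies all fixed bits.
  let pos : Fin t → GenVar m := fun v =>
    (⟨(⟨v + 1, hpos v⟩, ⟨v + 1, hpos v⟩), le_rfl⟩, ⟨0, hlog⟩)
  refine ⟨pos, genEncode (table hm 0), fun x => ⟨table hm x, fun v => ?_,
    fun u hu => ?_, gen_table_iff hm⟩⟩
  · change (entry m ops x (v + 1) (v + 1)).testBit 0 = _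
    rw [entry_switch, Nat.testBit_zero, litElt]
    have h1 : (2 * (t + 1) + 2 * v.1 + (x v).val) % 2 = (x v).val % 2 := by omega
    rw [h1]
    generalize x v = c
    revert c
    decide
  · obtain ⟨⟨⟨⟨i, hi⟩, ⟨j, hj⟩⟩, hij⟩, ⟨b, hb⟩⟩ := u
    change (entry m ops x i j).testBit b = (entry m ops 0 i j).testBit b
    by_cases h : ∃ v : Fin t, i = v + 1 ∧ j = v + 1
    · obtain ⟨v, rfl, rfl⟩ := h
      cases b with
      | zero => exact absurd ⟨v, rfl⟩ hu
      | succ b =>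
        have h1 : ∀ c, litElt t v c / 2 = t + 1 + v := by
          intro c
          have := val_lt_two c
          unfold litElt
          omega
        rw [entry_switch, entry_switch, Nat.testBit_add_one, Nat.testBit_add_one, h1, h1]
    · rw [entry_eq_of_not_switch 0 h]

/-- The evaluation steps for the parity check matrix with the columns `h v`: for each row, its
variables, followed by a test. -/
def checkOps {r t : ℕ} (h : Fin t → Fin r → ZMod 2) : List (Option (Fin t)) :=
  (List.finRange r).flatMap fun j =>
    ((List.finRange t).filter fun v => decide (h v j ≠ 0)).map some ++ [none]

/-- Count the nonzero matrix entries by columns; each of the `r` rows adds one test. -/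
theorem length_checkOps_le {r t w : ℕ} (h : Fin t → Fin r → ZMod 2)
    (hw : ∀ v, (Finset.univ.filter fun j => h v j ≠ 0).card ≤ w) :
    (checkOps h).length ≤ w * t + r := by
  have h1 : ∀ j, ((List.finRange t).filter fun v => decide (h v j ≠ 0)).length =
      (Finset.univ.filter fun v => h v j ≠ 0).card := by
    intro j
    rw [← List.toFinset_card_of_nodup ((List.nodup_finRange t).filter _)]
    congr 1
    ext v
    simp
  have h2 : (checkOps h).length = ∑ j, ((Finset.univ.filter fun v => h v j ≠ 0).card + 1) := by
    rw [checkOps, List.length_flatMap, ← List.ofFn_eq_map, List.sum_ofFn]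
    exact Finset.sum_congr rfl fun j _ => by
      rw [List.length_append, List.length_map, h1, List.length_singleton]
  rw [h2, Finset.sum_add_distrib]
  simp_rw [Finset.card_filter]
  rw [Finset.sum_comm]
  simp_rw [← Finset.card_filter]
  have h3 := Finset.sum_le_sum fun v (_ : v ∈ Finset.univ) => hw v
  simp only [Finset.sum_const, Finset.card_univ, Fintype.card_fin, smul_eq_mul, mul_one] at h3 ⊢
  lia

theorem foldl_checkStep_none {t : ℕ} (x : Fin t → ZMod 2) (l : List (Option (Fin t))) :
    l.foldl (checkStep x) none = none := by
  induction l with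
  | nil => rfl
  | cons o l ih => simpa [checkStep] using ih

theorem foldl_checkStep_map_some {t : ℕ} (x : Fin t → ZMod 2) (l : List (Fin t)) (s : ZMod 2) :
    (l.map some).foldl (checkStep x) (some s) = some (s + (l.map x).sum) := by
  induction l generalizing s with
  | nil => simp
  | cons v l ih => simp [checkStep, ih, add_assoc]

theorem checkRun_checkOps_iff {r t : ℕ} (h : Fin t → Fin r → ZMod 2) (x : Fin t → ZMod 2) :
    checkRun x (checkOps h) = some 0 ↔ ∑ v, x v • h v = 0 := by
  have hrow : ∀ j, (((List.finRange t).filter fun v => decide (h v j ≠ 0)).map x).sum =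
      ∑ v, x v * h v j := by
    intro j
    rw [← List.sum_toFinset _ ((List.nodup_finRange t).filter _), List.toFinset_filter,
      List.toFinset_finRange, Finset.sum_filter]
    refine Finset.sum_congr rfl fun v _ => ?_
    generalize h v j = c
    generalize x v = d
    revert c d
    decide
  have key : ∀ l : List (Fin r), checkRun x (l.flatMap fun j =>
      ((List.finRange t).filter fun v => decide (h v j ≠ 0)).map some ++ [none]) = some 0 ↔
      ∀ j ∈ l, ∑ v, x v * h v j = 0 := by
    intro l
    induction l with
    | nil => simp [checkRun]
    | cons j l ih =>
      rw [List.flatMap_cons, checkRun, List.foldl_append, List.foldl_append,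
        foldl_checkStep_map_some, hrow, zero_add, List.foldl_cons, List.foldl_nil, checkStep,
        List.forall_mem_cons, ← ih]
      split_ifs with h0
      · simp [h0, checkRun]
      · simp [h0, foldl_checkStep_none]
  rw [checkOps, key]
  simp only [List.mem_finRange, forall_const]
  rw [funext_iff]
  simp

/-! ### Restricting a branching program to the embedded variables -/

namespace NBP

variable {ι κ : Type} (B : NBP ι) (pos : κ → ι) (y : ι → Bool)

/-- An edge that is unlabelled or whose test is passed for the fixed values `y` of the variables
outside of the range of `pos`. -/
def Passable (e : B.E) : Prop :=
  ∀ u b, B.label e = some (u, b) → u ∉ Set.range pos ∧ y u = b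

/-- Reachability by passable edges. -/
def FreeReach : B.V → B.V → Prop :=
  Relation.ReflTransGen fun u w => ∃ e, B.Passable pos y e ∧ B.src e = u ∧ B.tgt e = w

/-- The edges that test a variable in the range of `pos`. -/
abbrev TestEdge : Type := {e : B.E // ∃ v b, B.label e = some (pos v, b)}

/-- The test on an edge, with the bits regarded as elements of `ZMod 2`. -/
noncomputable def testLit (e : B.TestEdge pos) : κ × ZMod 2 :=
  (e.2.choose, if e.2.choose_spec.choose then 1 else 0)

/-- One test edge can be the next one after another. -/
def NextTest (e e' : B.TestEdge pos) : Prop := B.FreeReach pos y (B.tgt e.1) (B.src e'.1)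

variable {B pos y}

theorem label_eq_testLit (e : B.TestEdge pos) :
    B.label e.1 = some (pos (B.testLit pos e).1, decide ((B.testLit pos e).2 = 1)) := by
  have h := e.2.choose_spec.choose_spec
  rw [h, testLit]
  cases e.2.choose_spec.choose <;> simp

theorem isPath_append {u v w : B.V} {p q : List B.E} (hp : B.IsPath u p v)
    (hq : B.IsPath v q w) : B.IsPath u (p ++ q) w := by
  induction p generalizing u with
  | nil =>
    have : u = v := hp
    subst this
    exact hq
  | cons e p ih => exact ⟨hp.1, ih hp.2⟩

theorem FreeReach.exists_isPath {u w : B.V} (h : B.FreeReach pos y u w) :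
    ∃ p, B.IsPath u p w ∧ ∀ e ∈ p, B.Passable pos y e := by
  induction h using Relation.ReflTransGen.head_induction_on with
  | refl => exact ⟨[], rfl, by simp⟩
  | head h _ ih =>
    obtain ⟨e, he, rfl, rfl⟩ := h
    obtain ⟨p, hp, hp'⟩ := ih
    exact ⟨e :: p, ⟨rfl, hp⟩, by simpa using ⟨he, hp'⟩⟩

theorem FreeReach.reflTransGen {u w : B.V} (h : B.FreeReach pos y u w) :
    Relation.ReflTransGen (fun u w => ∃ e, B.src e = u ∧ B.tgt e = w) u w :=
  Relation.ReflTransGen.mono (fun _ _ ⟨e, _, h⟩ => ⟨e, h⟩) _ _ h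

theorem nextTest_acyclic (e : B.TestEdge pos) :
    ¬ Relation.TransGen (B.NextTest pos y) e e := by
  intro h
  refine B.acyclic (B.src e.1) (Relation.TransGen.lift' (fun e : B.TestEdge pos => B.src e.1)
    (fun a b hab => ?_) _ _ h)
  exact Relation.TransGen.head' ⟨a.1, rfl, rfl⟩ (FreeReach.reflTransGen hab)

/-- An input that agrees with `y` outside of the range of `pos`. -/
def Extends (pos : κ → ι) (y : ι → Bool) (x : κ → ZMod 2) (X : ι → Bool) : Prop :=
  (∀ v, X (pos v) = decide (x v = 1)) ∧ ∀ u, u ∉ Set.range pos → X u = y u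

/-- The walk lists the test edges of the path in order; the first alternative is a path without test
edges. -/
theorem exists_isWalk_of_isPath {x : κ → ZMod 2} {X : ι → Bool} (hX : Extends pos y x X)
    {u w : B.V} {p : List B.E} (hp : B.IsPath u p w) (hc : B.Consistent p X) :
    B.FreeReach pos y u w ∨ ∃ a z q, B.FreeReach pos y u (B.src a.1) ∧
      B.FreeReach pos y (B.tgt z.1) w ∧ IsWalk (B.NextTest pos y) a q z ∧
      ∀ c ∈ q, x (B.testLit pos c).1 = (B.testLit pos c).2 := by
  induction p generalizing u with
  | nil =>
    have : u = w := hp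
    subst this
    exact Or.inl Relation.ReflTransGen.refl
  | cons e p ih =>
    obtain ⟨rfl, hp⟩ := hp
    have ih' := ih hp fun e he => hc e (List.mem_cons_of_mem _ he)
    have hce := hc e (by simp)
    by_cases he : ∃ v b, B.label e = some (pos v, b)
    · set a : B.TestEdge pos := ⟨e, he⟩
      have ha : x (B.testLit pos a).1 = (B.testLit pos a).2 := by
        have h1 := hce _ _ (label_eq_testLit a)
        rw [hX.1] at h1
        generalize x (B.testLit pos a).1 = c at *
        generalize (B.testLit pos a).2 = d at *
        revert c d
        decide
      right
      rcases ih' with h | ⟨a', z, q, h1, h2, h3, h4⟩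
      · exact ⟨a, a, [a], Relation.ReflTransGen.refl, h, IsWalk.singleton a, by simpa using ha⟩
      · refine ⟨a, z, [a] ++ q, Relation.ReflTransGen.refl, h2,
          (IsWalk.singleton a).append h1 h3, fun c hc => ?_⟩
        rcases List.mem_append.1 hc with hc | hc
        · rwa [List.mem_singleton.1 hc]
        · exact h4 c hc
    · have hpass : B.Passable pos y e := by
        intro u b hub
        have hu : u ∉ Set.range pos := by
          rintro ⟨v, rfl⟩
          exact he ⟨v, b, hub⟩
        exact ⟨hu, by rw [← hX.2 u hu]; exact hce u b hub⟩
      rcases ih' with h | ⟨a', z, q, h1, h2, h3, h4⟩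
      · exact Or.inl (Relation.ReflTransGen.head ⟨e, hpass, rfl, rfl⟩ h)
      · exact Or.inr ⟨a', z, q, Relation.ReflTransGen.head ⟨e, hpass, rfl, rfl⟩ h1, h2, h3, h4⟩

/-- Filling the gaps by passable edges works for every walk, consistent or not; hence the syntactic
read bound carries over to walks. -/
theorem exists_isPath_of_isWalk [DecidableEq ι] [DecidableEq κ] {u w : B.V}
    {a z : B.TestEdge pos} {q : List (B.TestEdge pos)} (hu : B.FreeReach pos y u (B.src a.1))
    (hw : B.FreeReach pos y (B.tgt z.1) w) (hq : IsWalk (B.NextTest pos y) a q z) :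
    ∃ p, B.IsPath u p w ∧
      (∀ v, (q.map fun c => (B.testLit pos c).1).count v ≤
        p.countP fun e => decide ((B.label e).map Prod.fst = some (pos v))) ∧
      ∀ e ∈ p, B.Passable pos y e ∨ ∃ c ∈ q, c.1 = e := by
  obtain ⟨hq1, hq2, hq3⟩ := hq
  induction q generalizing a u with
  | nil => simp at hq2
  | cons c q ih =>
    simp only [List.head?_cons, Option.some.injEq] at hq2
    subst hq2
    obtain ⟨p₁, hp₁, hp₁'⟩ := hu.exists_isPath
    have hrest : ∃ p₂, B.IsPath (B.tgt c.1) p₂ w ∧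
        (∀ v, (q.map fun c => (B.testLit pos c).1).count v ≤
          p₂.countP fun e => decide ((B.label e).map Prod.fst = some (pos v))) ∧
        ∀ e ∈ p₂, B.Passable pos y e ∨ ∃ c ∈ q, c.1 = e := by
      cases q with
      | nil =>
        simp only [List.getLast?_singleton, Option.some.injEq] at hq3
        subst hq3
        obtain ⟨p₂, hp₂, hp₂'⟩ := hw.exists_isPath
        exact ⟨p₂, hp₂, by simp, fun e he => Or.inl (hp₂' e he)⟩
      | cons d q =>
        rw [List.isChain_cons_cons] at hq1
        rw [List.getLast?_cons_cons] at hq3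
        exact ih hq1.1 hq1.2 rfl hq3
    obtain ⟨p₂, hp₂, hcount, hmem⟩ := hrest
    refine ⟨p₁ ++ c.1 :: p₂, isPath_append hp₁ ⟨rfl, hp₂⟩, fun v => ?_, fun e he => ?_⟩
    · rw [List.map_cons, List.count_cons, List.countP_append, List.countP_cons,
        label_eq_testLit c]
      have h1 := hcount v
      by_cases hv : (B.testLit pos c).1 = v
      · simp only [hv, Option.map_some, beq_self_eq_true, decide_true, if_true]
        lia
      · simp only [beq_iff_eq, hv, if_false]
        lia
    · rcases List.mem_append.1 he with he | he
      · exact Or.inl (hp₁' e he)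
      · rcases List.mem_cons.1 he with rfl | he
        · exact Or.inr ⟨c, by simp, rfl⟩
        · rcases hmem e he with h | ⟨d, hd, rfl⟩
          · exact Or.inl h
          · exact Or.inr ⟨d, List.mem_cons_of_mem _ hd, rfl⟩

theorem consistent_of_passable {x : κ → ZMod 2} {X : ι → Bool} (hX : Extends pos y x X)
    {p : List B.E} {q : List (B.TestEdge pos)}
    (hp : ∀ e ∈ p, B.Passable pos y e ∨ ∃ c ∈ q, c.1 = e)
    (hq : ∀ c ∈ q, x (B.testLit pos c).1 = (B.testLit pos c).2) : B.Consistent p X := by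
  intro e he u b hub
  rcases hp e he with h | ⟨c, hc, rfl⟩
  · obtain ⟨h1, h2⟩ := h u b hub
    rw [hX.2 u h1, h2]
  · rw [label_eq_testLit c] at hub
    simp only [Option.some.injEq, Prod.mk.injEq] at hub
    obtain ⟨rfl, rfl⟩ := hub
    rw [hX.1, hq c hc]

/-- The restriction of a program to the variables in the range of `pos`. -/
theorem eval_iff_walkAccepts [DecidableEq ι] [DecidableEq κ] {f : (ι → Bool) → Bool}
    (hf : B.Computes f) {x : κ → ZMod 2} {X : ι → Bool} (hX : Extends pos y x X) :
    f X = true ↔ B.FreeReach pos y B.source B.sink ∨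
      WalkAccepts (B.NextTest pos y) (B.testLit pos)
        (fun e => B.FreeReach pos y B.source (B.src e.1))
        (fun e => B.FreeReach pos y (B.tgt e.1) B.sink) x := by
  rw [hf X]
  constructor
  · rintro ⟨p, hp, hc⟩
    rcases exists_isWalk_of_isPath hX hp hc with h | ⟨a, z, q, h1, h2, h3, h4⟩
    · exact Or.inl h
    · exact Or.inr ⟨a, z, q, h1, h2, h3, h4⟩
  · rintro (h | ⟨a, z, q, h1, h2, h3, h4⟩)
    · obtain ⟨p, hp, hp'⟩ := h.exists_isPath
      exact ⟨p, hp, consistent_of_passable (q := []) hX (fun e he => Or.inl (hp' e he)) (by simp)⟩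
    · obtain ⟨p, hp, -, hp'⟩ := exists_isPath_of_isWalk h1 h2 h3
      exact ⟨p, hp, consistent_of_passable hX hp' h4⟩

theorem IsReadK.count_le [DecidableEq ι] [DecidableEq κ] {k : ℕ} (hk : B.IsReadK k)
    (a z : B.TestEdge pos) (q : List (B.TestEdge pos))
    (ha : B.FreeReach pos y B.source (B.src a.1)) (hz : B.FreeReach pos y (B.tgt z.1) B.sink)
    (hq : IsWalk (B.NextTest pos y) a q z) (v : κ) :
    (q.map fun c => (B.testLit pos c).1).count v ≤ k := by
  obtain ⟨p, hp, hcount, -⟩ := exists_isPath_of_isWalk ha hz hq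
  exact (hcount v).trans (hk p hp (pos v))

theorem finite_E : Finite B.E := @Finite.of_fintype _ B.fintypeE

theorem card_testEdge_le_size [Fintype (B.TestEdge pos)] :
    Fintype.card (B.TestEdge pos) ≤ B.size := by
  have := B.finite_E
  rw [← Nat.card_eq_fintype_card]
  refine Set.ncard_le_ncard (s := {e | ∃ v b, B.label e = some (pos v, b)}) ?_ (Set.toFinite _)
  rintro e ⟨v, b, h⟩
  simp [h]

end NBP

/-! ### Choice of parameters and the bound in terms of `m` -/

theorem choose_mul_le_pow (a b : ℕ) : (a * b).choose a ≤ (3 * b) ^ a := by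
  have h1 : ((a * b).choose a : ℝ) ≤ ((a * b : ℕ) : ℝ) ^ a / a.factorial :=
    Nat.choose_le_pow_div a (a * b)
  have h2 : (a : ℝ) ^ a / a.factorial ≤ 3 ^ a := by
    refine (Real.pow_div_factorial_le_exp (a : ℝ) (by positivity) a).trans ?_
    rw [← Real.exp_one_pow]
    exact pow_le_pow_left₀ (by positivity) (by linarith [Real.exp_one_lt_d9]) _
  have h3 : ((a * b).choose a : ℝ) ≤ (3 * b) ^ a := by
    refine h1.trans ?_
    push_cast
    rw [mul_pow, mul_pow, mul_div_right_comm]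
    gcongr
  exact_mod_cast h3

/-- Since `2 * 7 ^ 6 ≤ 8 ^ 6`, the quotient of the powers is at least `2 ^ (6 * k)`, which exceeds
`24 * 2 ^ k`. -/
theorem pow_seven_lt_pow_eight {k : ℕ} (hk : 1 ≤ k) :
    (3 * 2 ^ (k + 2)) * 2 * 7 ^ (36 * k) < 8 ^ (36 * k) := by
  have h1 : 2 ^ (6 * k) * 7 ^ (36 * k) ≤ 8 ^ (36 * k) := by
    rw [show 36 * k = 6 * (6 * k) by ring, pow_mul 7 6, pow_mul 8 6, ← mul_pow]
    exact Nat.pow_le_pow_left (by norm_num) _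
  have h2 : 32 ≤ 2 ^ (5 * k) := by
    calc 32 = 2 ^ 5 := by norm_num
      _ ≤ _ := Nat.pow_le_pow_right (by norm_num) (by lia)
  have h3 : 32 * 2 ^ k ≤ 2 ^ (6 * k) := by
    rw [show 6 * k = 5 * k + k by ring, pow_add]
    exact Nat.mul_le_mul_right _ h2
  refine lt_of_lt_of_le (Nat.mul_lt_mul_of_pos_right ?_ (by positivity)) h1
  have h4 : 0 < 2 ^ k := by positivity
  rw [pow_add]
  lia

/-- A sparse parity check matrix all of whose large sets of columns have large rank. -/
theorem exists_sparse_columns {k h t : ℕ} (hk : 1 ≤ k) (hh : 72 ≤ h)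
    (ht : t = 10 * (k * h) * 2 ^ (k + 2)) :
    ∃ H : Fin t → Fin (8 * (k * h)) → ZMod 2,
      (∀ v, (Finset.univ.filter fun j => H v j ≠ 0).card ≤ 72 * k) ∧
      ∀ A : Finset (Fin t), 10 * (k * h) ≤ A.card →
        5 * (k * h) ≤ Module.finrank (ZMod 2) (Submodule.span (ZMod 2) (H '' A)) := by
  classical
  subst ht
  set g := k * h with hg
  have hg0 : 72 * k ≤ g := by rw [hg, mul_comm]; exact Nat.mul_le_mul_left _ hh
  have : Nonempty (Fin (8 * g)) := ⟨⟨0, by lia⟩⟩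
  -- As `72 * k ≤ g`, the dimension bound `5 * g + 72 * k ≤ 6 * g` holds. Each slot then costs a
  -- factor `14 * g` out of `16 * g`, that is `7 / 8`, and `72 * k` slots suffice to beat the number
  -- of pairs in the union bound.
  obtain ⟨ω, hω⟩ := exists_family_finrank_le (ι := Fin (10 * g * 2 ^ (k + 2)))
    (sparseColumn (r := 8 * g) (w := 72 * k)) (ρ := 5 * g) (a := 10 * g)
    (q := (8 * g + 6 * g) ^ (72 * k))
    (fun U hU => card_sparseColumn_mem_le (w := 72 * k) (d := 6 * g) U (by lia))
    (by lia) (by rw [Fintype.card_fin]; exact Nat.le_mul_of_pos_right _ (by positivity)) (by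
      rw [Fintype.card_fin, Fintype.card_fun, Fintype.card_prod, Fintype.card_fin,
        Fintype.card_bool, Fintype.card_fin, show 10 * g - 5 * g = 5 * g by lia]
      have h1 := choose_mul_le_pow (10 * g) (2 ^ (k + 2))
      have h2 : ∀ c : ℕ, ((c * (2 * g)) ^ (72 * k)) ^ (5 * g) =
          (c ^ (36 * k)) ^ (10 * g) * (2 * g) ^ (72 * k * (5 * g)) := by
        intro c
        rw [← pow_mul, mul_pow, ← pow_mul]
        congr 2
        ring
      rw [show 8 * g + 6 * g = 7 * (2 * g) by ring, show 8 * g * 2 = 8 * (2 * g) by ring, h2, h2,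
        ← mul_assoc]
      refine Nat.mul_lt_mul_of_pos_right ?_ (Nat.pow_pos (by lia))
      calc _ ≤ (3 * 2 ^ (k + 2)) ^ (10 * g) * 2 ^ (10 * g) * (7 ^ (36 * k)) ^ (10 * g) := by
            gcongr
        _ = ((3 * 2 ^ (k + 2)) * 2 * 7 ^ (36 * k)) ^ (10 * g) := by
            rw [← mul_pow, ← mul_pow]
        _ < _ := Nat.pow_lt_pow_left (pow_seven_lt_pow_eight hk) (by lia))
  exact ⟨fun v => sparseColumn (ω v), fun v => card_support_sparseColumn_le _, hω⟩

/-- The lower bound for read-`k` programs for GEN, before taking roots. -/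
theorem NBP.two_pow_le_size_pow {m k h : ℕ} (hk : 1 ≤ k) (hh : 72 ≤ h)
    (hm : 6000 * (k ^ 2 * 2 ^ k * h) ≤ m) {f : (GenVar m → Bool) → Bool}
    (hf : IsBooleanGEN m f) {B : NBP (GenVar m)} (hB : B.IsReadK k) (hBf : B.Computes f) :
    2 ^ (2 * (k * h)) ≤ (B.size ^ 2 + 1) ^ (8 * (k ^ 2 * 2 ^ k) + 1) := by
  classical
  obtain ⟨t, ht⟩ : ∃ t, t = 10 * (k * h) * 2 ^ (k + 2) := ⟨_, rfl⟩
  obtain ⟨H, hsparse, hrank⟩ := exists_sparse_columns hk hh ht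
  have ht' : t = 40 * (k * h * 2 ^ k) := by rw [ht, pow_add]; ring
  have hkh : 72 ≤ k * h := hh.trans (Nat.le_mul_of_pos_left _ hk)
  have h2k : 2 ≤ 2 ^ k := Nat.le_self_pow (by lia) 2
  -- The dominant term is `2 * 72 * k * t = 5760 * (k ^ 2 * 2 ^ k * h)`.
  have htm : 4 * t + 2 * (checkOps H).length + 5 ≤ m := by
    have h1 := length_checkOps_le H hsparse
    have h2 : k * h * 2 ≤ k * h * 2 ^ k := Nat.mul_le_mul_left _ h2k
    have h3 : 72 * k * t = 2880 * (k ^ 2 * 2 ^ k * h) := by rw [ht']; ring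
    have h4 : k * h * 2 ^ k ≤ k ^ 2 * 2 ^ k * h := by
      calc k * h * 2 ^ k = 1 * (k * h * 2 ^ k) := by ring
        _ ≤ k * (k * h * 2 ^ k) := Nat.mul_le_mul_right _ hk
        _ = _ := by ring
    lia
  obtain ⟨pos, y, hy⟩ := exists_gen_embedding (checkOps H) htm
  have hcode : ∀ x : Fin t → ZMod 2, (∑ v, x v • H v = 0) ↔
      B.FreeReach pos y B.source B.sink ∨
      WalkAccepts (B.NextTest pos y) (B.testLit pos)
        (fun e => B.FreeReach pos y B.source (B.src e.1))
        (fun e => B.FreeReach pos y (B.tgt e.1) B.sink) x := by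
    intro x
    obtain ⟨X, hX1, hX2, hX3⟩ := hy x
    rw [← NBP.eval_iff_walkAccepts hBf ⟨hX1, hX2⟩, hf X, hX3, checkRun_checkOps_iff]
  -- Otherwise every `x` would be a codeword, so all columns would vanish.
  have hfree : ¬ B.FreeReach pos y B.source B.sink := by
    intro hfree
    have hH : ∀ v, H v = 0 := by
      intro v
      have := (hcode (Pi.single v 1)).2 (Or.inl hfree)
      simpa [Pi.single_apply, ite_smul] using this
    have h1 := hrank Finset.univ (by
      rw [Finset.card_univ, Fintype.card_fin, ht]
      exact Nat.le_mul_of_pos_right _ (by positivity))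
    have h2 : Submodule.span (ZMod 2) (H '' (Finset.univ : Finset (Fin t))) = ⊥ := by
      rw [Submodule.span_eq_bot]
      rintro _ ⟨v, -, rfl⟩
      exact hH v
    rw [h2, finrank_bot] at h1
    lia
  simp only [hfree, false_or] at hcode
  have := B.finite_E
  have : Fintype (B.TestEdge pos) := Fintype.ofFinite _
  set L := 8 * (k ^ 2 * 2 ^ k) + 1 with hL
  have ht10 : 10 * (k * h) ≤ t := ht ▸ Nat.le_mul_of_pos_right _ (by positivity)
  -- `M + 1 = 5 * h` and `s = 10 * (k * h)` make the two size conditions of the cover equalities.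
  -- `L` is the least number with `k * t < L * (M + 1)`, and `D` comes from rank `5 * (k * h)` on
  -- each side.
  have hcount := card_walkAccepts_le (R := B.NextTest pos y) (lit := B.testLit pos)
    (S := fun e => B.FreeReach pos y B.source (B.src e.1))
    (T := fun e => B.FreeReach pos y (B.tgt e.1) B.sink) (k := k) (M := 5 * h - 1) (L := L)
    (s := 10 * (k * h)) (D := 2 ^ (t - 10 * (k * h)))
    NBP.nextTest_acyclic (fun a z p ha hz hp v => hB.count_le a z p ha hz hp v)
    (by
      rw [Fintype.card_fin, Nat.sub_add_cancel (by lia), ht', hL]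
      have : k * (40 * (k * h * 2 ^ k)) = 8 * (k ^ 2 * 2 ^ k) * (5 * h) := by ring
      rw [this, add_mul]
      lia)
    (by
      rw [Fintype.card_fin, Nat.sub_add_cancel (by lia), ht']
      exact le_of_eq (by ring))
    (by
      rw [Fintype.card_fin, ht]
      exact le_of_eq (by ring))
    (fun Q A A' hQ hAA' hA hA' hrect => by
      have h1 := hrect.card_le hAA' (fun x hx => (hcode x).2 (hQ x hx)) (hrank A hA)
        (hrank A' hA')
      rw [Fintype.card_fin] at h1
      refine Nat.le_of_mul_le_mul_left (h1.trans_eq ?_)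
        (show 0 < 2 ^ (2 * (5 * (k * h))) by positivity)
      rw [← pow_add]
      congr 1
      lia)
  have hker := two_pow_card_le_card_ker_partialCheck H (r := 8 * (k * h)) (by simp)
  have hker' : Nat.card (LinearMap.ker (partialCheck H Finset.univ)) =
      (Finset.univ.filter fun x : Fin t → ZMod 2 =>
        WalkAccepts (B.NextTest pos y) (B.testLit pos)
        (fun e => B.FreeReach pos y B.source (B.src e.1))
        (fun e => B.FreeReach pos y (B.tgt e.1) B.sink) x).card := by
    rw [Nat.card_eq_fintype_card, Fintype.card_subtype]
    congr 1
    ext x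
    rw [Finset.mem_filter, Finset.mem_filter, ← hcode x, LinearMap.mem_ker, partialCheck_apply]
  rw [hker', Fintype.card_fin] at hker
  have hsize : (Fintype.card (B.TestEdge pos) ^ 2 + 1) ^ L ≤ (B.size ^ 2 + 1) ^ L := by
    have := NBP.card_testEdge_le_size (B := B) (pos := pos)
    gcongr
  have hfinal : 2 ^ t ≤ 2 ^ (8 * (k * h)) * ((B.size ^ 2 + 1) ^ L * 2 ^ (t - 10 * (k * h))) :=
    hker.trans (Nat.mul_le_mul_left _ (hcount.trans (Nat.mul_le_mul_right _ hsize)))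
  have hsplit : 2 ^ t = 2 ^ (8 * (k * h)) * (2 ^ (2 * (k * h)) * 2 ^ (t - 10 * (k * h))) := by
    rw [← pow_add, ← pow_add]
    congr 1
    lia
  rw [hsplit] at hfinal
  exact Nat.le_of_mul_le_mul_right (Nat.le_of_mul_le_mul_left hfinal (by positivity))
    (by positivity)

/-! ### Trivial size bound and final estimates -/

/-- The table with the products `a` and `b` of the first and the second element with themselves, and
all other products equal to the first element. -/
def twoEntryTable {m : ℕ} (hm : 3 ≤ m) (a b : Fin m) : GenPair m → Fin m := fun p =>
  if p.1.1.val = 0 ∧ p.1.2.val = 0 then a else if p.1.1.val = 1 ∧ p.1.2.val = 1 then b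
  else ⟨0, by lia⟩

theorem GEN_twoEntryTable_last {m : ℕ} (hm : 3 ≤ m) (b : Fin m) :
    GEN (twoEntryTable hm ⟨m - 1, by lia⟩ b) = true := by
  simp only [GEN, decide_eq_true_eq]
  refine ⟨⟨m - 1, by lia⟩, by simp only; lia, ?_⟩
  exact Generated.mul (X := twoEntryTable hm ⟨m - 1, by lia⟩ b)
    ⟨(⟨0, by lia⟩, ⟨0, by lia⟩), le_rfl⟩ ⟨0, by lia⟩ ⟨0, by lia⟩ rfl rfl
    (.one _ rfl) (.one _ rfl)

theorem GEN_twoEntryTable_one_last {m : ℕ} (hm : 3 ≤ m) :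
    GEN (twoEntryTable hm ⟨1, by lia⟩ ⟨m - 1, by lia⟩) = true := by
  simp only [GEN, decide_eq_true_eq]
  refine ⟨⟨m - 1, by lia⟩, by simp only; lia, ?_⟩
  have h1 : Generated (twoEntryTable hm ⟨1, by lia⟩ ⟨m - 1, by lia⟩) ⟨1, by lia⟩ :=
    Generated.mul (X := twoEntryTable hm ⟨1, by lia⟩ ⟨m - 1, by lia⟩)
      ⟨(⟨0, by lia⟩, ⟨0, by lia⟩), le_rfl⟩ ⟨0, by lia⟩ ⟨0, by lia⟩ rfl rfl
      (.one _ rfl) (.one _ rfl)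
  exact Generated.mul (X := twoEntryTable hm ⟨1, by lia⟩ ⟨m - 1, by lia⟩)
    ⟨(⟨1, by lia⟩, ⟨1, by lia⟩), le_rfl⟩ ⟨1, by lia⟩ ⟨1, by lia⟩ rfl rfl h1 h1

theorem GEN_twoEntryTable_zero {m : ℕ} (hm : 3 ≤ m) (a : Fin m) (ha : a.val + 1 ≠ m) :
    GEN (twoEntryTable hm a ⟨0, by lia⟩) = false := by
  simp only [GEN, decide_eq_false_iff_not, not_exists, not_and]
  intro c hc hgen
  have : c.val = 0 ∨ c = a := by
    cases hgen with
    | one _ h => exact Or.inl h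
    | mul p =>
      unfold twoEntryTable
      split_ifs <;> simp
  rcases this with h | h
  · lia
  · exact ha (h ▸ hc)

theorem NBP.eq_of_labels_eq {ι : Type} {B : NBP ι} {f : (ι → Bool) → Bool} (hf : B.Computes f)
    {u : ι} (hu : ∀ e i b, B.label e = some (i, b) → i = u) {x y : ι → Bool} (hxy : x u = y u) :
    f x = f y := by
  have key : ∀ x y : ι → Bool, x u = y u → f x = true → f y = true := by
    intro x y hxy hx
    obtain ⟨p, hp, hc⟩ := (hf x).1 hx
    refine (hf y).2 ⟨p, hp, fun e he i b hib => ?_⟩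
    have h1 := hc e he i b hib
    obtain rfl := hu e i b hib
    rw [← hxy, h1]
  exact Bool.eq_iff_iff.2 ⟨key x y hxy, key y x hxy.symm⟩

/-- This makes `logb 2 B.size` at least one, which settles small `m`. With at most one labelled
edge, the output on tables would depend on a single entry. -/
theorem NBP.two_le_size {m : ℕ} (hm : 3 ≤ m) {f : (GenVar m → Bool) → Bool}
    (hf : IsBooleanGEN m f) {B : NBP (GenVar m)} (hB : B.Computes f) : 2 ≤ B.size := by
  by_contra! hsize
  have := B.finite_E
  have hone : ∀ e e', B.label e ≠ none → B.label e' ≠ none → e = e' := by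
    intro e e' he he'
    exact (Set.ncard_le_one (Set.toFinite _)).1 (show B.size ≤ 1 by lia) e he e' he'
  have hu : ∃ u : GenVar m, ∀ e i b, B.label e = some (i, b) → i = u := by
    by_cases h : ∃ e i b, B.label e = some (i, b)
    · obtain ⟨e, i, b, he⟩ := h
      refine ⟨i, fun e' i' b' he' => ?_⟩
      obtain rfl := hone e e' (by simp [he]) (by simp [he'])
      rw [he] at he'
      simp only [Option.some.injEq, Prod.mk.injEq] at he'
      exact he'.1.symm
    · refine ⟨(⟨(⟨0, by lia⟩, ⟨0, by lia⟩), le_rfl⟩, ⟨0, Nat.clog_pos (by norm_num) (by lia)⟩),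
        fun e i b he => absurd ⟨e, i, b, he⟩ h⟩
  obtain ⟨u, hu⟩ := hu
  have hsame : ∀ X Y : GenPair m → Fin m, X u.1 = Y u.1 → GEN X = GEN Y := by
    intro X Y hXY
    rw [← hf X, ← hf Y]
    refine NBP.eq_of_labels_eq hB hu ?_
    simp [genEncode, hXY]
  -- If the tested entry is the square of the first element, fix that to be the second element and
  -- vary the square of the second; otherwise vary the square of the first.
  by_cases hu0 : u.1.1.1.val = 0 ∧ u.1.1.2.val = 0
  · have := hsame (twoEntryTable hm ⟨1, by lia⟩ ⟨m - 1, by lia⟩)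
      (twoEntryTable hm ⟨1, by lia⟩ ⟨0, by lia⟩) (by simp [twoEntryTable, hu0])
    rw [GEN_twoEntryTable_one_last, GEN_twoEntryTable_zero hm _ (by simp only; lia)] at this
    exact absurd this (by decide)
  · have := hsame (twoEntryTable hm ⟨m - 1, by lia⟩ ⟨0, by lia⟩)
      (twoEntryTable hm ⟨0, by lia⟩ ⟨0, by lia⟩) (by simp [twoEntryTable, hu0])
    rw [GEN_twoEntryTable_last, GEN_twoEntryTable_zero hm _ (by simp only; lia)] at this
    exact absurd this (by decide)

/-- The lower bound for read-`k` programs for GEN in terms of the number of elements. -/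
theorem NBP.div_le_logb_size {m k : ℕ} (hm : 3 ≤ m) (hk : 1 ≤ k)
    {f : (GenVar m → Bool) → Bool} (hf : IsBooleanGEN m f) {B : NBP (GenVar m)}
    (hB : B.IsReadK k) (hBf : B.Computes f) :
    1 / 432000 * (m / (4 ^ k * (k : ℝ) ^ 3)) ≤ Real.logb 2 B.size := by
  have hs := NBP.two_le_size hm hf hBf
  have hs' : (2 : ℝ) ≤ B.size := by exact_mod_cast hs
  have hlog : 1 ≤ Real.logb 2 B.size := by
    rw [Real.le_logb_iff_rpow_le (by norm_num) (by linarith), Real.rpow_one]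
    exact hs'
  set K := k ^ 2 * 2 ^ k with hK
  have hk' : (1 : ℝ) ≤ k := by exact_mod_cast hk
  have hK0 : 0 < K := by positivity
  have hKr : (4 : ℝ) ^ k * (k : ℝ) ^ 3 = (2 : ℝ) ^ k * k * K := by
    rw [hK, show (4 : ℝ) = 2 * 2 by norm_num, mul_pow]
    push_cast
    ring
  have hKk : (K : ℝ) * K = (2 : ℝ) ^ k * k * K * k := by
    rw [hK]
    push_cast
    ring
  have h2k : (1 : ℝ) ≤ (2 : ℝ) ^ k := one_le_pow₀ (by norm_num)
  have hpos : (0 : ℝ) < (2 : ℝ) ^ k * k * K := by positivity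
  set h := m / (6000 * K) with hh
  rw [hKr]
  -- For `h < 72` the left side is at most one; this fixes the constant `432000 = 72 * 6000`.
  rcases lt_or_ge h 72 with hlt | hge
  · have h1 : m < 72 * (6000 * K) := (Nat.div_lt_iff_lt_mul (by positivity)).1 (hh ▸ hlt)
    have h2 : (m : ℝ) ≤ 432000 * K := by
      have : (m : ℝ) ≤ ((72 * (6000 * K) : ℕ) : ℝ) := by exact_mod_cast h1.le
      push_cast at this
      linarith
    have h3 : (m : ℝ) / ((2 : ℝ) ^ k * k * K) ≤ 432000 := by
      rw [div_le_iff₀ hpos]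
      have : (1 : ℝ) ≤ (2 : ℝ) ^ k * k := one_le_mul_of_one_le_of_one_le h2k hk'
      nlinarith [(Nat.cast_pos (α := ℝ)).2 hK0]
    linarith
  · have hmh : 6000 * (K * h) ≤ m := by
      rw [← mul_assoc]
      exact Nat.mul_div_le m _
    have hpow := NBP.two_pow_le_size_pow hk hge hmh hf hB hBf
    -- `size ^ 2 + 1 ≤ size ^ 3` and `8 * K + 1 ≤ 9 * K` give the exponent `27 * K`.
    have hpow3 : 2 ^ (2 * (k * h)) ≤ B.size ^ (27 * K) := by
      refine hpow.trans ?_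
      have h1 : B.size ^ 2 + 1 ≤ B.size ^ 3 := by
        have : 1 ≤ B.size ^ 2 := Nat.one_le_pow _ _ (by lia)
        calc B.size ^ 2 + 1 ≤ B.size ^ 2 * 2 := by lia
          _ ≤ B.size ^ 2 * B.size := Nat.mul_le_mul_left _ hs
          _ = B.size ^ 3 := by ring
      calc (B.size ^ 2 + 1) ^ (8 * K + 1) ≤ (B.size ^ 3) ^ (9 * K) :=
            (Nat.pow_le_pow_left h1 _).trans
              (Nat.pow_le_pow_right (Nat.pow_pos (by lia)) (by lia))
        _ = _ := by rw [← pow_mul]; congr 1; ring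
    have hlogpow : (2 * (k * h) : ℝ) ≤ 27 * K * Real.logb 2 B.size := by
      have h1 : (2 : ℝ) ^ (2 * (k * h)) ≤ (B.size : ℝ) ^ (27 * K) := by exact_mod_cast hpow3
      have h2 := Real.logb_le_logb_of_le (b := 2) (by norm_num) (by positivity) h1
      rw [Real.logb_pow, Real.logb_pow, Real.logb_self_eq_one (by norm_num)] at h2
      push_cast at h2
      linarith
    have hm2 : (m : ℝ) ≤ 12000 * K * h := by
      have h1 : m < 6000 * K * (h + 1) := Nat.lt_mul_div_succ m (by positivity)
      have h2 : (m : ℝ) ≤ ((6000 * K * (h + 1) : ℕ) : ℝ) := by exact_mod_cast h1.le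
      push_cast at h2
      have h3 : (1 : ℝ) ≤ h := by exact_mod_cast (by lia : 1 ≤ h)
      have h4 : (K : ℝ) ≤ K * h := le_mul_of_one_le_right (by positivity) h3
      linarith
    have h5 : (m : ℝ) * k ≤ 162000 * ((2 : ℝ) ^ k * k * K * k) * Real.logb 2 B.size := by
      rw [← hKk]
      calc (m : ℝ) * k ≤ 12000 * K * h * k := by gcongr
        _ = 6000 * K * (2 * (k * h)) := by ring
        _ ≤ 6000 * K * (27 * K * Real.logb 2 B.size) := by gcongr
        _ = _ := by ring
    have h6 : (m : ℝ) ≤ 162000 * Real.logb 2 B.size * ((2 : ℝ) ^ k * k * K) := by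
      refine le_of_mul_le_mul_right (h5.trans_eq ?_) (show (0 : ℝ) < k by linarith)
      ring
    have h7 := (div_le_iff₀ hpos).2 h6
    linarith

theorem Nat.clog_two_le_two_mul_logb {m : ℕ} (hm : 2 ≤ m) :
    (Nat.clog 2 m : ℝ) ≤ 2 * Real.logb 2 m := by
  have hm' : (2 : ℝ) ≤ m := by exact_mod_cast hm
  have h1 : 2 ^ (Nat.clog 2 m).pred < m := Nat.pow_pred_clog_lt_self (by norm_num) (by lia)
  have h2 : (2 : ℝ) ^ (Nat.clog 2 m - 1) ≤ m := by exact_mod_cast h1.le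
  have h3 := Real.logb_le_logb_of_le (b := 2) (by norm_num) (by positivity) h2
  rw [Real.logb_pow, Real.logb_self_eq_one (by norm_num), mul_one,
    Nat.cast_sub (Nat.clog_pos (by norm_num) (by lia)), Nat.cast_one] at h3
  have h4 : 1 ≤ Real.logb 2 m := by
    rw [Real.le_logb_iff_rpow_le (by norm_num) (by linarith), Real.rpow_one]
    exact hm'
  linarith

theorem mainTheorem3 :
    ∃ c : ℝ, 0 < c ∧ ∃ n₀ : ℕ, ∀ m n N k : ℕ, 2 ≤ m →
      n = m * (m - 1) / 2 → N = n * Nat.clog 2 m → n₀ ≤ n → 1 ≤ k →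
      ∀ f : (GenVar m → Bool) → Bool, IsBooleanGEN m f →
      ∀ B : NBP (GenVar m), B.IsReadK k → B.Computes f →
        (2 : ℝ) ^ (c * (√(n : ℝ) / (4 ^ k * (k : ℝ) ^ 3 * √(Real.logb 2 n)))) ≤ (B.size : ℝ) ∧
        (2 : ℝ) ^ (c * (√(N : ℝ) / (4 ^ k * (k : ℝ) ^ 3 * √(Real.logb 2 N)))) ≤ (B.size : ℝ) := by
  -- The threshold `3` only excludes `m = 2`.
  refine ⟨1 / 432000, by norm_num, 3, fun m n N k hm hn hN hn3 hk f hf B hB hBf => ?_⟩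
  have hm3 : 3 ≤ m := by
    by_contra! hlt
    obtain rfl : m = 2 := by lia
    norm_num at hn
    lia
  have hbound := NBP.div_le_logb_size hm3 hk hf hB hBf
  have hs : (2 : ℝ) ≤ B.size := by exact_mod_cast NBP.two_le_size hm3 hf hBf
  have hk' : (1 : ℝ) ≤ k := by exact_mod_cast hk
  have hmn : m ≤ n := by
    rw [hn, Nat.le_div_iff_mul_le (by norm_num)]
    exact Nat.mul_le_mul_left _ (by lia)
  have hnm : 2 * n ≤ m ^ 2 := by
    have h1 : n * 2 ≤ m * (m - 1) := hn ▸ Nat.div_mul_le_self _ _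
    have h2 : m * (m - 1) ≤ m * m := Nat.mul_le_mul_left _ (by lia)
    rw [sq]
    lia
  have hclog : 1 ≤ Nat.clog 2 m := Nat.clog_pos (by norm_num) (by lia)
  have hnN : n ≤ N := hN ▸ Nat.le_mul_of_pos_right _ hclog
  have hlogm : 1 ≤ Real.logb 2 m := by
    have hm' : (2 : ℝ) ≤ m := by exact_mod_cast hm
    rw [Real.le_logb_iff_rpow_le (by norm_num) (by linarith), Real.rpow_one]
    exact hm'
  have hm0 : (0 : ℝ) < m := by exact_mod_cast (by lia : 0 < m)
  have hnr : (2 * n : ℝ) ≤ m ^ 2 := by exact_mod_cast hnm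
  have hlog : ∀ a : ℕ, m ≤ a → Real.logb 2 m ≤ Real.logb 2 a := fun a ha =>
    Real.logb_le_logb_of_le (by norm_num) hm0 (by exact_mod_cast ha)
  -- Both bounds need only `a ≤ m ^ 2 * logb 2 a`. For `a = N`, the factor two lost in rounding the
  -- logarithm up is absorbed by `2 * n ≤ m ^ 2`.
  have key : ∀ a : ℕ, m ≤ a → (a : ℝ) ≤ m ^ 2 * Real.logb 2 a →
      (2 : ℝ) ^ (1 / 432000 * (√(a : ℝ) / (4 ^ k * (k : ℝ) ^ 3 * √(Real.logb 2 a)))) ≤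
        (B.size : ℝ) := by
    intro a hma ha
    rw [← Real.le_logb_iff_rpow_le (by norm_num) (by linarith)]
    refine le_trans ?_ hbound
    have hla : 0 < Real.logb 2 a := by linarith [hlog a hma]
    have h1 : √(a : ℝ) ≤ m * √(Real.logb 2 a) := by
      rw [← Real.sqrt_sq hm0.le, ← Real.sqrt_mul (by positivity)]
      exact Real.sqrt_le_sqrt ha
    have h2 : 0 < √(Real.logb 2 a) := Real.sqrt_pos.2 hla
    refine mul_le_mul_of_nonneg_left ?_ (by norm_num)
    rw [div_le_div_iff₀ (by positivity) (by positivity)]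
    calc √(a : ℝ) * (4 ^ k * (k : ℝ) ^ 3) ≤ m * √(Real.logb 2 a) * (4 ^ k * (k : ℝ) ^ 3) := by
          gcongr
      _ = _ := by ring
  refine ⟨key n hmn ?_, key N (hmn.trans hnN) ?_⟩
  · have h1 := hlog n hmn
    have h2 : (0 : ℝ) ≤ n := Nat.cast_nonneg n
    nlinarith [sq_nonneg (m : ℝ)]
  · have h1 := hlog N (hmn.trans hnN)
    have h2 := Nat.clog_two_le_two_mul_logb hm
    rw [hN] at h1 ⊢
    push_cast at h1 ⊢
    calc (n : ℝ) * Nat.clog 2 m ≤ n * (2 * Real.logb 2 m) := by gcongr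
      _ = 2 * n * Real.logb 2 m := by ring
      _ ≤ m ^ 2 * Real.logb 2 (n * Nat.clog 2 m) := by gcongr
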